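/- Let $G$ be a $\sigma$-compact, locally compact Hausdorff group that is amenable and not unimodular. Write $|E|$ for a regular left Haar measure of $E\subseteq G$, and let $\Delta$ be the modular function, $|Ex|=|E|\,\Delta(x)$. A mean is a positive linear functional of norm one on $L_\infty(G)$; we write $m(E)=m(\mathbf 1_E)$ for a mean $m$ and a measurable set $E$. With $l_x\phi(y)=\phi(x^{-1}y)$ and $(f*\phi)(y)=\int_G f(x)\phi(x^{-1}y)\,dx$, a mean $m$ is left-invariant if $m(\phi)=m(l_x\phi)$ for all $x\in G$ and $\phi\in L_\infty(G)$ (amenable means that a left-invariant mean exists), and topological left-invariant if $m(\phi)=m(f*\phi)$ for all $\phi\in L_\infty(G)$ and all $f\in L_1(G)$ with $f\ge 0$, $\|f\|_1=1$. Let $\mathrm{TLIM}(G)$ be the set of topological left-invariant means. Let $\mathrm{TLIM}_0(G)$ (the limit points of topological Følner nets) be the set of those $m\in\mathrm{TLIM}(G)$ such that for every finite measurable partition $\mathcal P$ of $G$, every compact $K\subseteq G$ and every $\epsilon\in(0,1)$ there is a compact set $A\subseteq G$ with $|A|>0$, with $|A\,\triangle\, xA|/|A|<\epsilon$ for all $x\in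 K$, and with $\bigl|\,m(E)-|A\cap E|/|A|\,\bigr|<\epsilon$ for all $E\in\mathcal P$. Then $\mathrm{TLIM}_0(G)\neq\mathrm{TLIM}(G)$. More precisely: 1. For every $\delta>0$ there are $\mu,\nu\in\mathrm{TLIM}_0(G)$ and measurable sets $X\subseteq\{x:\Delta(x)\ge 1\}$ and $Y\subseteq\{x:\Delta(x)\le\delta\}$ with $|Y|\le 1$, $\mu(X)=1$ and $\nu(Y)=1$. 2. Whenever $\mu,\nu\in\mathrm{TLIM}_0(G)$ and $X,Y\subseteq G$ are measurable sets with $X\subseteq\{x:\Delta(x)\ge1\}$, $|Y|<\infty$, $\mu(X)=1$ and $\nu(Y)=1$, the midpoint $\tfrac12(\mu+\nu)$ belongs to $\mathrm{TLIM}(G)\setminus\mathrm{TLIM}_0(G)$. -/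

import Mathlib

open MeasureTheory MeasureTheory.Measure Set Topology
open scoped ENNReal NNReal Pointwise symmDiff ComplexOrder

namespace FolnerLimits

section

variable {G : Type*} [Group G] [TopologicalSpace G] [IsTopologicalGroup G]
  [LocallyCompactSpace G] [T2Space G] [SigmaCompactSpace G] [MeasurableSpace G] [BorelSpace G]

/-- Inversion preserves null sets of a regular Haar measure. -/
theorem inv_absolutelyContinuous (μ : Measure G) [μ.IsHaarMeasure] [μ.Regular] :
    μ.inv ≪ μ := by
  refine AbsolutelyContinuous.mk fun N hN hμN => ?_
  by_contra hne
  obtain ⟨K, hKN, hK, hKpos⟩ :=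
    MeasurableSet.exists_lt_isCompact (μ := μ.inv) hN (pos_iff_ne_zero.2 hne)
  have hμK : μ K = 0 := measure_mono_null hKN hμN
  obtain ⟨⟨g, g_cont⟩, g_comp, g_nonneg, g_one⟩ :
    ∃ g : C(G, ℝ), HasCompactSupport g ∧ 0 ≤ g ∧ g 1 ≠ 0 := exists_continuous_nonneg_pos 1
  have hgpos : 0 < ∫ x, g x ∂μ :=
    g_cont.integral_pos_of_hasCompactSupport_nonneg_nonzero g_comp g_nonneg g_one
  set D : G → ℝ := fun x => ∫ y, g (y⁻¹ * x) ∂μ.inv with hD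
  have D_cont : Continuous D := continuous_integral_apply_inv_mul g_cont g_comp
  have D_pos : ∀ x, 0 < D x := by
    intro x
    have C : Continuous (fun y ↦ g (y⁻¹ * x)) := by fun_prop
    apply (integral_pos_iff_support_of_nonneg _ _).2
    · apply C.isOpen_support.measure_pos μ.inv
      exact ⟨x, by simpa using g_one⟩
    · exact fun y ↦ g_nonneg (y⁻¹ * x)
    · apply C.integrable_of_hasCompactSupport
      exact g_comp.comp_homeomorph ((Homeomorph.inv G).trans (Homeomorph.mulRight x))
  have hKne : K.Nonempty := nonempty_of_measure_ne_zero hKpos.ne'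
  obtain ⟨x₀, -, hx₀⟩ := hK.exists_isMaxOn hKne D_cont.continuousOn
  have hc : 0 < (D x₀)⁻¹ := inv_pos.2 (D_pos x₀)
  have hKr : 0 < μ.inv.real K := ENNReal.toReal_pos hKpos.ne' hK.measure_lt_top.ne
  set a : ℝ := (D x₀)⁻¹ * μ.inv.real K * ∫ x, g x ∂μ with ha
  have ha0 : 0 < a := by positivity
  have key := hK.measure_eq_biInf_integral_hasCompactSupport μ
  have hle : ENNReal.ofReal a ≤ μ K := by
    rw [key]
    refine le_iInf fun f => le_iInf fun hf => le_iInf fun hfc => le_iInf fun hfK =>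
      le_iInf fun hf0 => ENNReal.ofReal_le_ofReal ?_
    rw [integral_isMulLeftInvariant_isMulRightInvariant_combo (ν := μ.inv) hf hfc g_cont g_comp
      g_nonneg g_one]
    refine mul_le_mul_of_nonneg_right ?_ hgpos.le
    have hint : Integrable (fun y => f y * (D y)⁻¹) μ.inv := by
      apply Continuous.integrable_of_hasCompactSupport
      · exact hf.mul (D_cont.inv₀ fun x => (D_pos x).ne')
      · exact hfc.mul_right
    calc (D x₀)⁻¹ * μ.inv.real K = ∫ y in K, (D x₀)⁻¹ ∂μ.inv := by
          rw [setIntegral_const, smul_eq_mul, mul_comm]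
      _ ≤ ∫ y in K, f y * (D y)⁻¹ ∂μ.inv := by
          refine setIntegral_mono_on ?_ hint.integrableOn hK.measurableSet ?_
          · exact integrableOn_const hK.measure_lt_top.ne
          · intro y hy
            have h1 : f y = 1 := hfK hy
            rw [h1, one_mul]
            exact inv_anti₀ (D_pos y) (hx₀ hy)
      _ ≤ ∫ y, f y * (D y)⁻¹ ∂μ.inv :=
          setIntegral_le_integral hint
            (Filter.Eventually.of_forall fun y => mul_nonneg (hf0 y) (inv_pos.2 (D_pos y)).le)
  rw [hμK] at hle
  exact absurd (ENNReal.ofReal_pos.2 ha0) (not_lt.2 hle)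

/-- Pointwise convolution `(f * φ)(y) = ∫ f(x) φ(x⁻¹ y) dx`. -/
noncomputable def convFun (μ : Measure G) (f : Lp ℝ 1 μ) (φ : Lp ℂ ∞ μ) (y : G) : ℂ :=
  ∫ x, f x • φ (x⁻¹ * y) ∂μ

/-- The essential bound of `φ` survives inversion. -/
theorem ae_norm_inv_le (μ : Measure G) [μ.IsHaarMeasure] [μ.Regular] (φ : Lp ℂ ∞ μ) :
    ∀ᵐ x ∂μ, ‖φ x⁻¹‖ ≤ ‖φ‖ := by
  have h : ∀ᵐ x ∂μ, ‖φ x‖ ≤ ‖φ‖ := by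
    have := ae_le_eLpNormEssSup (f := φ) (μ := μ)
    filter_upwards [this] with x hx
    rw [Lp.norm_def, eLpNorm_exponent_top, ← toReal_enorm]
    refine ENNReal.toReal_mono ?_ hx
    rw [← eLpNorm_exponent_top]
    exact Lp.eLpNorm_ne_top φ
  have h2 := (inv_absolutelyContinuous μ).ae_le h
  exact (ae_map_iff measurable_inv.aemeasurable
    (measurableSet_le (Lp.stronglyMeasurable φ).norm.measurable measurable_const)).1 h2

theorem integral_smul_inv_bound (μ : Measure G) [μ.IsHaarMeasure] [μ.Regular]
    (f : Lp ℝ 1 μ) (φ : Lp ℂ ∞ μ) :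
    Integrable (fun x => f x • φ x⁻¹) μ ∧ ‖∫ x, f x • φ x⁻¹ ∂μ‖ ≤ ‖φ‖ * ‖f‖ := by
  have hb : ∀ᵐ x ∂μ, ‖f x • φ x⁻¹‖ ≤ ‖φ‖ * ‖f x‖ := by
    filter_upwards [ae_norm_inv_le μ φ] with x hx
    rw [norm_smul, mul_comm]
    gcongr
  have hi : Integrable (fun x => ‖φ‖ * ‖f x‖) μ := (L1.integrable_coeFn f).norm.const_mul _
  refine ⟨hi.mono' ?_ hb, ?_⟩
  · exact (Lp.aestronglyMeasurable f).smul
      ((Lp.stronglyMeasurable φ).comp_measurable measurable_inv).aestronglyMeasurable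
  · refine (norm_integral_le_of_norm_le hi hb).trans ?_
    rw [integral_const_mul, L1.norm_eq_integral_norm]

set_option linter.unusedSectionVars false in
theorem convFun_eq (μ : Measure G) [μ.IsHaarMeasure] [μ.Regular]
    (f : Lp ℝ 1 μ) (φ : Lp ℂ ∞ μ) (y : G) :
    convFun μ f φ y =
      ∫ x, (Lp.compMeasurePreserving (fun z => y * z) (measurePreserving_mul_left μ y) f : Lp ℝ 1 μ) x
        • φ x⁻¹ ∂μ := by
  rw [convFun, ← integral_mul_left_eq_self _ y]
  refine integral_congr_ae ?_
  filter_upwards [Lp.coeFn_compMeasurePreserving f (measurePreserving_mul_left μ y)] with x hx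
  rw [hx]
  simp [mul_assoc]

theorem continuous_convFun (μ : Measure G) [μ.IsHaarMeasure] [μ.Regular]
    (f : Lp ℝ 1 μ) (φ : Lp ℂ ∞ μ) : Continuous (convFun μ f φ) := by
  have hT : Continuous fun y : G =>
      (Lp.compMeasurePreserving (fun z => y * z) (measurePreserving_mul_left μ y) f : Lp ℝ 1 μ) := by
    let g : C(G, C(G, G)) := (ContinuousMap.mk (fun a : G × G ↦ a.1 * a.2) continuous_mul).curry
    exact (continuous_const (y := f)).compMeasurePreservingLp (g := fun y => g y) g.continuous
      (fun y => measurePreserving_mul_left μ y) ENNReal.one_ne_top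
  have hJ : Continuous fun h : Lp ℝ 1 μ => ∫ x, h x • φ x⁻¹ ∂μ := by
    refine (LipschitzWith.of_dist_le_mul (K := ‖φ‖₊) fun h k => ?_).continuous
    rw [dist_eq_norm, dist_eq_norm, ← integral_sub (integral_smul_inv_bound μ h φ).1
      (integral_smul_inv_bound μ k φ).1]
    refine le_trans (le_of_eq ?_) (integral_smul_inv_bound μ (h - k) φ).2
    congr 1
    refine integral_congr_ae ?_
    filter_upwards [Lp.coeFn_sub h k] with x hx
    rw [hx, Pi.sub_apply, sub_smul]
  exact (hJ.comp hT).congr fun y => (convFun_eq μ f φ y).symm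

theorem memLp_convFun (μ : Measure G) [μ.IsHaarMeasure] [μ.Regular]
    (f : Lp ℝ 1 μ) (φ : Lp ℂ ∞ μ) : MemLp (convFun μ f φ) ∞ μ := by
  refine memLp_top_of_bound (continuous_convFun μ f φ).measurable.aestronglyMeasurable
    (‖φ‖ * ‖f‖) (Filter.Eventually.of_forall fun y => ?_)
  rw [convFun_eq]
  refine (integral_smul_inv_bound μ _ φ).2.trans (le_of_eq ?_)
  rw [Lp.norm_compMeasurePreserving]

/-- The convolution `f * φ` as an element of `L∞(G)`. -/
noncomputable def conv (μ : Measure G) [μ.IsHaarMeasure] [μ.Regular]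
    (f : Lp ℝ 1 μ) (φ : Lp ℂ ∞ μ) : Lp ℂ ∞ μ :=
  (memLp_convFun μ f φ).toLp (convFun μ f φ)

/-- Left translation `(l_x φ)(y) = φ(x⁻¹ y)` on `L∞(G)`. -/
noncomputable def leftTranslate (μ : Measure G) [μ.IsHaarMeasure] (x : G) (φ : Lp ℂ ∞ μ) :
    Lp ℂ ∞ μ :=
  Lp.compMeasurePreserving (fun y => x⁻¹ * y) (measurePreserving_mul_left μ x⁻¹) φ

/-- The class of the indicator function of a measurable set `E` in `L∞(G)`. -/
noncomputable def ind (μ : Measure G) (E : Set G) (hE : MeasurableSet E) : Lp ℂ ∞ μ :=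
  ((memLp_top_const (1 : ℂ)).indicator hE).toLp (E.indicator fun _ => (1 : ℂ))

/-- The means on `L∞(G)`: positive functionals of norm one. -/
def Means (μ : Measure G) : Set (StrongDual ℂ (Lp ℂ ∞ μ)) :=
  {m | ‖m‖ = 1 ∧ ∀ φ : Lp ℂ ∞ μ, (∀ᵐ x ∂μ, 0 ≤ φ x) → 0 ≤ m φ}

/-- `P₁(G)`: the nonnegative functions of norm one in `L¹(G)`. -/
def P₁ (μ : Measure G) : Set (Lp ℝ 1 μ) :=
  {f | 0 ≤ f ∧ ‖f‖ = 1}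

/-- The left-invariant means on `L∞(G)`. -/
def LIM (μ : Measure G) [μ.IsHaarMeasure] : Set (StrongDual ℂ (Lp ℂ ∞ μ)) :=
  {m | m ∈ Means μ ∧ ∀ (x : G) (φ : Lp ℂ ∞ μ), m φ = m (leftTranslate μ x φ)}

/-- `G` is amenable: there is a left-invariant mean on `L∞(G)`. -/
def IsAmenable (μ : Measure G) [μ.IsHaarMeasure] : Prop :=
  (LIM μ).Nonempty

/-- The topological left-invariant means on `L∞(G)`. -/
def TLIM (μ : Measure G) [μ.IsHaarMeasure] [μ.Regular] : Set (StrongDual ℂ (Lp ℂ ∞ μ)) :=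
  {m | m ∈ Means μ ∧ ∀ f ∈ P₁ μ, ∀ φ : Lp ℂ ∞ μ, m φ = m (conv μ f φ)}

/-- The compact sets `A` of positive measure that are `(K, ε)`-invariant:
`|A ∆ xA| / |A| < ε` for all `x ∈ K`. -/
def invariantSets (μ : Measure G) (K : Set G) (ε : ℝ) : Set (Set G) :=
  {A | IsCompact A ∧ 0 < μ A ∧ ∀ x ∈ K, μ.real (A ∆ (x • A)) / μ.real A < ε}

/-- The limit points of topological Følner nets. For `A` compact of positive measure,
`|A ∩ E| / |A|` is the value at `E` of the mean `φ ↦ |A|⁻¹ ∫_A φ`; sets of means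
that are close to `m` on the members of a finite measurable partition form a
neighbourhood basis of `m` in the set of means, for the weak-* topology. -/
def TLIM₀ (μ : Measure G) [μ.IsHaarMeasure] [μ.Regular] : Set (StrongDual ℂ (Lp ℂ ∞ μ)) :=
  {m | m ∈ TLIM μ ∧
    ∀ (P : Finpartition (univ : Set G)) (hP : ∀ E ∈ P.parts, MeasurableSet E)
      (K : Set G) (ε : ℝ), IsCompact K → 0 < ε → ε < 1 →
      ∃ A ∈ invariantSets μ K ε, ∀ (E : Set G) (hE : E ∈ P.parts),
        ‖m (ind μ E (hP E hE)) - ((μ.real (A ∩ E) / μ.real A : ℝ) : ℂ)‖ < ε}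

end

section

variable {G : Type*} [Group G] [TopologicalSpace G] [IsTopologicalGroup G]
  [LocallyCompactSpace G]

/-- The modular function, normalized by `|E x| = |E| Δ(x)` for left Haar measure; Mathlib's
`modularCharacter` is normalized by `|E x⁻¹| = |E| Δ(x)`. -/
noncomputable def modular (x : G) : ℝ≥0 :=
  modularCharacter x⁻¹

theorem measure_mul_right_eq [MeasurableSpace G] [BorelSpace G] (μ : Measure G)
    [μ.IsHaarMeasure] [μ.Regular] (E : Set G) (x : G) :
    μ ((fun y => y * x) '' E) = modular x * μ E := by
  have h : map (· * x⁻¹) μ = modularCharacterFun x⁻¹ • μ := by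
    rw [modularCharacterFun_eq_haarScalarFactor μ]
    have : Regular (map (· * x⁻¹) μ) := Regular.map (Homeomorph.mulRight x⁻¹)
    exact isMulLeftInvariant_eq_smul_of_regular _ μ
  have h2 := congrArg (fun ν : Measure G => ν E) h
  rw [image_mul_right]
  have h3 : map (· * x⁻¹) μ E = μ ((fun y => y * x⁻¹) ⁻¹' E) :=
    (MeasurableEquiv.mulRight x⁻¹).map_apply E
  rw [← h3, h]
  rfl

variable (G) in
/-- `G` is unimodular: its modular function is trivial. -/
def IsUnimodular : Prop :=
  ∀ x : G, modular x = 1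

end

end FolnerLimits

/-! A right translate `At` of a left Følner set `A` has the same invariance ratios as `A`, while its
measure is `Δ(t)|A|`. Since `Δ` is a nontrivial homomorphism, it takes arbitrarily large and
arbitrarily small values. A Følner sequence can therefore be moved into `{Δ ≥ 1}`, or into `{Δ ≤ δ}`
with measures summing to at most 1. Weak-* limits along a free ultrafilter give the two concentrated
means (`exists_TLIM₀_concentrated`).

Their midpoint is topologically left-invariant by convexity, but no single almost invariant set
approximates it (`notMem_TLIM₀_of_half_le`). Such a set `A` would have a fixed share of its mass in
`Y`, so `|A|` would be at most a constant times `|Y|`, whatever `K` is. It would also have a fixed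
share `B = A ∩ X` in `{Δ ≥ 1}`, where `|B⁻¹| = ∫_B 1/Δ ≤ |B|`. Almost invariance keeps `|A ∩ xB|`
above a fixed fraction of `|A|` for `x ∈ K`, whereas Fubini gives `∫_K |A ∩ xB| dx ≤ |B⁻¹||A| ≤
|A|²`. So `|A|` is at least a constant times `|K|`, which is absurd once `|K|` is large compared
with `|Y|`.

The rest derives Følner's condition from a left-invariant mean `m` (`nonempty_invariantSets`). For
fixed `φ`, the functional `f ↦ Re m(f * φ)` on `L¹` is translation-invariant, hence a multiple of
the integral. Day's separation argument turns this into almost invariant elements of `P₁`, and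
smoothing by a convolution makes the invariance uniform on compact sets (Reiter). Slicing into level
sets gives sets that are almost invariant on average over a compact set, and composing two good
translations makes the estimate uniform. -/

namespace FolnerLimits

set_option linter.unusedSectionVars false

/-! ### Uniqueness of Haar measure and its behaviour under right translation -/

section Haar

variable {G : Type*} [Group G] [TopologicalSpace G] [IsTopologicalGroup G]
  [LocallyCompactSpace G] [MeasurableSpace G] [BorelSpace G]

/-- On a `σ`-compact group, left-invariant measures that are finite on compact sets are
proportional to a Haar measure, without any regularity assumption. -/
theorem exists_eq_smul_of_isMulLeftInvariant [SigmaCompactSpace G] (ν μ : Measure G)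
    [μ.IsHaarMeasure] [IsFiniteMeasureOnCompacts ν] [ν.IsMulLeftInvariant] :
    ∃ c : ℝ≥0, ν = c • μ := by
  refine ⟨haarScalarFactor ν μ, ?_⟩
  ext E -
  -- Uniqueness of Haar measure holds without regularity on sets with compact closure, and
  -- `σ`-compactness exhausts any set by an increasing sequence of these.
  have hE : E = ⋃ n, E ∩ compactCovering G n := by
    rw [← inter_iUnion, iUnion_compactCovering, inter_univ]
  have hmono : Monotone fun n => E ∩ compactCovering G n := fun m n h =>
    inter_subset_inter_right _ (compactCovering_subset G h)
  rw [hE, hmono.measure_iUnion, hmono.measure_iUnion]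
  refine iSup_congr fun n => ?_
  exact measure_isMulInvariant_eq_smul_of_isCompact_closure ν μ
    ((isCompact_compactCovering G n).closure.of_isClosed_subset isClosed_closure
      (closure_mono inter_subset_right))

variable (μ : Measure G) [μ.IsHaarMeasure] [μ.Regular]

theorem map_mul_right_eq (x : G) : map (· * x) μ = modularCharacter x • μ := by
  change _ = modularCharacterFun x • μ
  rw [modularCharacterFun_eq_haarScalarFactor μ]
  have : Regular (map (· * x) μ) := Regular.map (Homeomorph.mulRight x)
  exact isMulLeftInvariant_eq_smul_of_regular _ μ

theorem lintegral_comp_mul_right (x : G) (k : G → ℝ≥0∞) :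
    ∫⁻ y, k (y * x) ∂μ = modularCharacter x * ∫⁻ y, k y ∂μ := by
  have h := lintegral_map_equiv (μ := μ) k (MeasurableEquiv.mulRight x)
  rw [MeasurableEquiv.coe_mulRight, map_mul_right_eq μ x, lintegral_smul_measure] at h
  exact h.symm

theorem integral_comp_mul_right {E : Type*} [NormedAddCommGroup E] [NormedSpace ℝ E]
    (x : G) (k : G → E) :
    ∫ y, k (y * x) ∂μ = modularCharacter x • ∫ y, k y ∂μ := by
  have h := integral_map_equiv (μ := μ) (MeasurableEquiv.mulRight x) k
  rw [MeasurableEquiv.coe_mulRight, map_mul_right_eq μ x, integral_smul_nnreal_measure] at h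
  exact h.symm

end Haar

/-! ### The modular function -/

section Modular

variable {G : Type*} [Group G] [TopologicalSpace G] [IsTopologicalGroup G]
  [LocallyCompactSpace G]

/-- Right translation by `x` multiplies the integral of a bump function `g` by the character at `x`.
The character is thus a convolution-type integral, continuous in `x`, divided by a positive
constant. -/
theorem continuous_modularCharacter : Continuous (modularCharacter : G → ℝ≥0) := by
  borelize G
  set ν : Measure G := haar
  obtain ⟨⟨g, g_cont⟩, g_comp, g_nonneg, g_one⟩ :
    ∃ g : C(G, ℝ), HasCompactSupport g ∧ 0 ≤ g ∧ g 1 ≠ 0 := exists_continuous_nonneg_pos 1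
  have hgpos : 0 < ∫ x, g x ∂ν :=
    g_cont.integral_pos_of_hasCompactSupport_nonneg_nonzero g_comp g_nonneg g_one
  have hD := continuous_integral_apply_inv_mul (μ := ν.inv) g_cont g_comp
  have key (x : G) : (∫ y, g (y⁻¹ * x) ∂ν.inv) / ∫ y, g y ∂ν = modularCharacter x := by
    have h1 : ∫ y, g (y⁻¹ * x) ∂ν.inv = ∫ y, g (y * x) ∂ν := by
      have := integral_map_equiv (μ := ν) (MeasurableEquiv.inv G) fun y => g (y⁻¹ * x)
      simpa [Measure.inv] using this
    rw [h1, integral_comp_mul_right ν x g, NNReal.smul_def, smul_eq_mul,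
      mul_div_cancel_right₀ _ hgpos.ne']
  rw [NNReal.isEmbedding_coe.continuous_iff]
  exact (hD.div_const _).congr key

theorem modularCharacter_pos (x : G) : 0 < modularCharacter x :=
  modularCharacterFun_pos x

theorem modularCharacter_inv (x : G) : modularCharacter x⁻¹ = (modularCharacter x)⁻¹ :=
  eq_inv_of_mul_eq_one_left (by rw [← map_mul, inv_mul_cancel, map_one])

theorem continuous_modular : Continuous (modular : G → ℝ≥0) :=
  continuous_modularCharacter.comp continuous_inv

theorem modular_eq_inv (x : G) : modular x = (modularCharacter x)⁻¹ :=
  modularCharacter_inv x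

theorem modular_mul (x y : G) : modular (x * y) = modular x * modular y := by
  simp [modular, mul_comm]

theorem modular_pos (x : G) : 0 < modular x :=
  modularCharacter_pos _

end Modular

/-! ### Haar measure under inversion -/

section Inversion

variable {G : Type*} [Group G] [TopologicalSpace G] [IsTopologicalGroup G]
  [LocallyCompactSpace G] [T2Space G] [SigmaCompactSpace G] [MeasurableSpace G] [BorelSpace G]
  (μ : Measure G) [μ.IsHaarMeasure] [μ.Regular]

/-- Haar measure is the image under inversion of the measure with density the modular
character. -/
theorem map_inv_withDensity_modularCharacter :
    map Inv.inv (μ.withDensity fun x => (modularCharacter x : ℝ≥0∞)) = μ := by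
  have hm : Measurable fun x : G => (modularCharacter x : ℝ≥0∞) :=
    (ENNReal.continuous_coe.comp continuous_modularCharacter).measurable
  set ν : Measure G := map Inv.inv (μ.withDensity fun x => (modularCharacter x : ℝ≥0∞)) with hν
  have hint (k : G → ℝ≥0∞) (hk : Measurable k) :
      ∫⁻ x, k x ∂ν = ∫⁻ x, modularCharacter x * k x⁻¹ ∂μ := by
    rw [hν, lintegral_map hk measurable_inv]
    exact lintegral_withDensity_eq_lintegral_mul _ hm (hk.comp measurable_inv)
  have : ν.IsMulLeftInvariant := by
    rw [← forall_measure_preimage_mul_iff]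
    intro g A hA
    have hgA : MeasurableSet ((fun h => g * h) ⁻¹' A) := measurable_const_mul g hA
    rw [← lintegral_indicator_one hA, ← lintegral_indicator_one hgA,
      hint _ (measurable_one.indicator hgA), hint _ (measurable_one.indicator hA)]
    -- The factor `modularCharacter g⁻¹` that right translation extracts from the measure is also
    -- extracted from the density by multiplicativity, so the two cancel.
    have h1 := lintegral_comp_mul_right μ g⁻¹ fun x => (modularCharacter x : ℝ≥0∞) *
      A.indicator 1 x⁻¹
    have hg : (modularCharacter g⁻¹ : ℝ≥0∞) ≠ 0 := by
      exact_mod_cast (modularCharacter_pos g⁻¹).ne'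
    rw [← ENNReal.mul_right_inj hg ENNReal.coe_ne_top, ← h1,
      ← lintegral_const_mul' _ _ ENNReal.coe_ne_top]
    refine lintegral_congr fun x => ?_
    rw [map_mul, ENNReal.coe_mul, mul_comm (modularCharacter x : ℝ≥0∞) (modularCharacter g⁻¹),
      mul_assoc]
    congr 2
    rw [mul_inv_rev, inv_inv]
    rfl
  have : IsFiniteMeasureOnCompacts ν := by
    refine ⟨fun K hK => ?_⟩
    rw [← lintegral_indicator_one hK.measurableSet,
      hint _ (measurable_one.indicator hK.measurableSet)]
    obtain ⟨C, hC⟩ := hK.inv.bddAbove_image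
      (continuous_modularCharacter (G := G)).continuousOn
    calc ∫⁻ x, modularCharacter x * K.indicator 1 x⁻¹ ∂μ
        ≤ ∫⁻ x, (C : ℝ≥0∞) * K⁻¹.indicator 1 x ∂μ := by
          refine lintegral_mono fun x => ?_
          by_cases hx : x ∈ K⁻¹
          · have : modularCharacter x ≤ C := hC ⟨x, hx, rfl⟩
            have hx' : x⁻¹ ∈ K := hx
            simpa [hx, hx'] using this
          · have hx' : x⁻¹ ∉ K := hx
            simp [hx, hx']
      _ = C * μ K⁻¹ := by
          rw [lintegral_const_mul' _ _ ENNReal.coe_ne_top,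
            lintegral_indicator_one hK.inv.measurableSet]
      _ < ∞ := ENNReal.mul_lt_top ENNReal.coe_lt_top hK.inv.measure_lt_top
  obtain ⟨c, hc⟩ := exists_eq_smul_of_isMulLeftInvariant ν μ
  have hint' (k : G → ℝ≥0∞) (hk : Measurable k) :
      ∫⁻ x, modularCharacter x * k x⁻¹ ∂μ = c * ∫⁻ x, k x ∂μ := by
    rw [← hint k hk, hc, lintegral_smul_measure]
    rfl
  obtain ⟨K, hK, hK1⟩ := exists_compact_mem_nhds (1 : G)
  have hKpos : μ K ≠ 0 := (measure_pos_of_mem_nhds μ hK1).ne'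
  have hKmeas : Measurable (K.indicator 1 : G → ℝ≥0∞) :=
    measurable_one.indicator hK.measurableSet
  -- The operation `k ↦ modularCharacter · k(·⁻¹)` is an involution and multiplies integrals by `c`;
  -- applying it twice to the indicator of `K` gives `c² = 1`.
  have h2 := hint' (fun x => modularCharacter x * K.indicator 1 x⁻¹)
    (hm.mul (hKmeas.comp measurable_inv))
  rw [hint' _ hKmeas] at h2
  have h3 (x : G) : (modularCharacter x : ℝ≥0∞) * (modularCharacter x⁻¹ * K.indicator 1 x⁻¹⁻¹) =
      K.indicator 1 x := by
    rw [← mul_assoc, ← ENNReal.coe_mul, ← map_mul]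
    simp
  simp_rw [h3, lintegral_indicator_one hK.measurableSet] at h2
  rw [← mul_assoc] at h2
  have h4 : (c * c : ℝ≥0∞) = 1 := by
    rw [← ENNReal.mul_left_inj hKpos hK.measure_lt_top.ne, ← h2, one_mul]
  have h5 : c * c = 1 := by exact_mod_cast h4
  have h6 : c = 1 := (pow_eq_one_iff_of_nonneg zero_le two_ne_zero).1 (by rw [pow_two, h5])
  rw [hc, h6, one_smul]

theorem integral_modularCharacter_smul_comp_inv {E : Type*} [NormedAddCommGroup E]
    [NormedSpace ℝ E] (k : G → E) :
    ∫ x, modularCharacter x • k x⁻¹ ∂μ = ∫ x, k x ∂μ := by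
  conv_rhs => rw [← map_inv_withDensity_modularCharacter μ]
  have h := integral_map_equiv (μ := μ.withDensity fun x => (modularCharacter x : ℝ≥0∞))
    (MeasurableEquiv.inv G) k
  change ∫ y, k y ∂map Inv.inv _ = ∫ x, k x⁻¹ ∂_ at h
  rw [h, integral_withDensity_eq_integral_smul continuous_modularCharacter.measurable]

theorem measure_inv_eq_setLIntegral {E : Set G} (hE : MeasurableSet E) :
    μ E⁻¹ = ∫⁻ x in E, modularCharacter x ∂μ := by
  conv_lhs => rw [← map_inv_withDensity_modularCharacter μ]
  rw [map_apply measurable_inv hE.inv, ← withDensity_apply _ hE]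
  simp

/-- `|E⁻¹|` is the integral of `1/Δ` over `E`, and `1/Δ ≤ 1` there. This is how the condition `X ⊆
{Δ ≥ 1}` enters the main argument. -/
theorem measure_inv_le_of_one_le_modular {E : Set G} (hE : MeasurableSet E)
    (h : E ⊆ {x | 1 ≤ modular x}) : μ E⁻¹ ≤ μ E := by
  rw [measure_inv_eq_setLIntegral μ hE, ← setLIntegral_one]
  refine setLIntegral_mono measurable_const fun x hx => ?_
  have := h hx
  rw [mem_ofPred_eq, modular_eq_inv, one_le_inv₀ (modularCharacter_pos x)] at this
  exact_mod_cast this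

end Inversion

/-! ### Essential bounds -/

section Bounds

variable {α : Type*} [MeasurableSpace α] (μ : Measure α)

theorem ae_norm_le (φ : Lp ℂ ∞ μ) : ∀ᵐ x ∂μ, ‖φ x‖ ≤ ‖φ‖ := by
  filter_upwards [ae_le_eLpNormEssSup (f := φ) (μ := μ)] with x hx
  rw [Lp.norm_def, eLpNorm_exponent_top, ← toReal_enorm]
  refine ENNReal.toReal_mono ?_ hx
  rw [← eLpNorm_exponent_top]
  exact Lp.eLpNorm_ne_top φ

theorem norm_integral_smul_le {ψ : α → ℂ} {C : ℝ} (g : Lp ℝ 1 μ)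
    (hC : ∀ᵐ x ∂μ, ‖ψ x‖ ≤ C) : ‖∫ y, g y • ψ y ∂μ‖ ≤ C * ‖g‖ := by
  rw [L1.norm_eq_integral_norm, ← integral_const_mul]
  refine norm_integral_le_of_norm_le ((L1.integrable_coeFn g).norm.const_mul _) ?_
  filter_upwards [hC] with x hx
  rw [norm_smul, mul_comm]
  gcongr

end Bounds

/-! ### Fubini's theorem for convolutions -/

section Fubini

variable {G : Type*} [Group G] [TopologicalSpace G] [IsTopologicalGroup G]
  [LocallyCompactSpace G] [T2Space G] [SigmaCompactSpace G] [MeasurableSpace G] [BorelSpace G]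
  (μ : Measure G) [μ.IsHaarMeasure] [μ.Regular]

/-- `G` need not be second countable, so Borel sets of `G × G` may fail to be measurable for the
product `σ`-algebra. A continuous function of compact support is still measurable for it, and `ψ`
depends on one coordinate only. -/
theorem integral_integral_swap_smul_of_hasCompactSupport {F : G → G → ℝ}
    (hF : Continuous F.uncurry) (hF' : HasCompactSupport F.uncurry) {ψ : G → ℂ}
    (hψ : AEStronglyMeasurable ψ μ) {C : ℝ} (hC : ∀ᵐ x ∂μ, ‖ψ x‖ ≤ C) :
    ∫ y, ∫ x, F y x • ψ x ∂μ ∂μ = ∫ x, (∫ y, F y x ∂μ) • ψ x ∂μ := by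
  have hint : Integrable F.uncurry (μ.prod μ) := by
    have hc1 := hF'.isCompact.image continuous_fst
    have hc2 := hF'.isCompact.image continuous_snd
    have hs : tsupport F.uncurry ⊆
        (Prod.fst '' tsupport F.uncurry) ×ˢ (Prod.snd '' tsupport F.uncurry) :=
      fun p hp => ⟨mem_image_of_mem _ hp, mem_image_of_mem _ hp⟩
    rw [← integrableOn_iff_integrable_of_support_subset ((subset_tsupport _).trans hs)]
    obtain ⟨M, hM⟩ := hF.bounded_above_of_compact_support hF'
    refine Measure.integrableOn_of_bounded (M := M) ?_
      (hF'.stronglyMeasurable_of_prod hF).aestronglyMeasurable (.of_forall hM)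
    rw [Measure.prod_prod]
    exact ENNReal.mul_ne_top hc1.measure_lt_top.ne hc2.measure_lt_top.ne
  have hint2 : Integrable (Function.uncurry fun y x => F y x • ψ x) (μ.prod μ) := by
    refine hint.smul_bdd C (hψ.comp_snd) ?_
    exact Measure.quasiMeasurePreserving_snd.ae hC
  rw [integral_integral_swap hint2]
  exact integral_congr_ae (.of_forall fun x => integral_smul_const _ _)

theorem hasCompactSupport_mul_comp_mul {u v : G → ℝ} (hu : HasCompactSupport u)
    (hv : HasCompactSupport v) :
    HasCompactSupport (Function.uncurry fun y x => u y * v (y * x)) := by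
  have h : HasCompactSupport fun p : G × G => u p.1 * v p.2 := by
    refine HasCompactSupport.intro (hu.isCompact.prod hv.isCompact) fun p hp => ?_
    rw [mem_prod, not_and_or] at hp
    rcases hp with hp | hp
    · rw [image_eq_zero_of_notMem_tsupport hp, zero_mul]
    · rw [image_eq_zero_of_notMem_tsupport hp, mul_zero]
  exact h.comp_homeomorph (Homeomorph.shearMulRight G)

/-- Left translations of the inner variable leave `φ` depending on that variable alone, so both
iterated integrals can be swapped. The results differ by an inversion, whose modular factor matches
the one coming from a right translation. -/
theorem fubini_of_hasCompactSupport {f g : G → ℝ} (hf : Continuous f) (hf' : HasCompactSupport f)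
    (hg : Continuous g) (hg' : HasCompactSupport g) (φ : Lp ℂ ∞ μ) :
    ∫ y, g y • ∫ x, f x • φ (x⁻¹ * y) ∂μ ∂μ = ∫ x, f x • ∫ y, g y • φ (x⁻¹ * y) ∂μ ∂μ := by
  have h1 (y : G) : g y • ∫ x, f x • φ (x⁻¹ * y) ∂μ =
      ∫ x, (g y * f (y * x)) • φ x⁻¹ ∂μ := by
    rw [← integral_smul, ← integral_mul_left_eq_self _ y]
    simp [mul_assoc, mul_smul]
  have h2 (x : G) : f x • ∫ y, g y • φ (x⁻¹ * y) ∂μ = ∫ y, (f x * g (x * y)) • φ y ∂μ := by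
    rw [← integral_smul, ← integral_mul_left_eq_self _ x]
    simp [mul_smul]
  simp_rw [h1, h2]
  rw [integral_integral_swap_smul_of_hasCompactSupport μ (F := fun y x => g y * f (y * x))
      (by fun_prop) (hasCompactSupport_mul_comp_mul hg' hf')
      (ψ := fun x => φ x⁻¹) (C := ‖φ‖) ((Lp.stronglyMeasurable φ).comp_measurable measurable_inv).aestronglyMeasurable
      (ae_norm_inv_le μ φ),
    integral_integral_swap_smul_of_hasCompactSupport μ (F := fun y x => f y * g (y * x))
      (by fun_prop) (hasCompactSupport_mul_comp_mul hf' hg') (C := ‖φ‖)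
      (Lp.aestronglyMeasurable φ) (ae_norm_le μ φ),
    ← integral_modularCharacter_smul_comp_inv μ fun x => (∫ y, f y * g (y * x) ∂μ) • φ x]
  refine integral_congr_ae (.of_forall fun x => ?_)
  have h3 : ∫ y, g y * f (y * x) ∂μ = modularCharacter x • ∫ y, f y * g (y * x⁻¹) ∂μ := by
    rw [← integral_comp_mul_right μ x fun y => f y * g (y * x⁻¹)]
    simp [mul_comm]
  simp only [h3, smul_assoc]

theorem dense_hasCompactSupport :
    Dense {f : Lp ℝ 1 μ | ∃ u : G → ℝ, Continuous u ∧ HasCompactSupport u ∧ f =ᵐ[μ] u} := by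
  intro f
  refine Metric.mem_closure_iff.2 fun ε hε => ?_
  obtain ⟨u, hu, hfu, huc, hul⟩ := (Lp.memLp f).exists_hasCompactSupport_eLpNorm_sub_le
    ENNReal.one_ne_top (ε := ENNReal.ofReal (ε / 2)) (by simpa using hε)
  refine ⟨hul.toLp u, ⟨u, huc, hu, hul.coeFn_toLp⟩, ?_⟩
  have : f = (Lp.memLp f).toLp f := (Lp.toLp_coeFn f _).symm
  rw [this, dist_edist, Lp.edist_toLp_toLp]
  refine (ENNReal.toReal_le_of_le_ofReal (by positivity) hfu).trans_lt (by linarith)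

theorem norm_convFun_le (f : Lp ℝ 1 μ) (φ : Lp ℂ ∞ μ) (y : G) :
    ‖convFun μ f φ y‖ ≤ ‖φ‖ * ‖f‖ := by
  rw [convFun_eq]
  refine (integral_smul_inv_bound μ _ φ).2.trans (le_of_eq ?_)
  rw [Lp.norm_compMeasurePreserving]

theorem ae_comp_inv_mul {p : G → Prop} (hp : ∀ᵐ z ∂μ, p z) (y : G) :
    ∀ᵐ x ∂μ, p (x⁻¹ * y) := by
  have h : QuasiMeasurePreserving (fun x : G => x⁻¹) μ μ :=
    ⟨measurable_inv, inv_absolutelyContinuous μ⟩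
  have h2 := h.comp (measurePreserving_mul_left μ y⁻¹).quasiMeasurePreserving
  refine (h2.ae hp).mono fun x hx => ?_
  simpa using hx

theorem integrable_smul_comp_inv_mul (f : Lp ℝ 1 μ) (φ : Lp ℂ ∞ μ) (y : G) :
    Integrable (fun x => f x • φ (x⁻¹ * y)) μ :=
  (L1.integrable_coeFn f).smul_bdd ‖φ‖
    ((Lp.stronglyMeasurable φ).comp_measurable (by fun_prop)).aestronglyMeasurable
    (ae_comp_inv_mul μ (ae_norm_le μ φ) y)

theorem convFun_sub_left (f f' : Lp ℝ 1 μ) (φ : Lp ℂ ∞ μ) (y : G) :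
    convFun μ (f - f') φ y = convFun μ f φ y - convFun μ f' φ y := by
  rw [convFun, convFun, convFun, ← integral_sub (integrable_smul_comp_inv_mul μ f φ y)
    (integrable_smul_comp_inv_mul μ f' φ y)]
  refine integral_congr_ae ?_
  filter_upwards [Lp.coeFn_sub f f'] with x hx
  rw [hx, Pi.sub_apply, sub_smul]

theorem integrable_smul_comp_mul_left (g : Lp ℝ 1 μ) (φ : Lp ℂ ∞ μ) (x : G) :
    Integrable (fun y => g y • φ (x * y)) μ :=
  (L1.integrable_coeFn g).smul_bdd ‖φ‖
    ((Lp.stronglyMeasurable φ).comp_measurable (by fun_prop)).aestronglyMeasurable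
    ((measurePreserving_mul_left μ x).quasiMeasurePreserving.ae (ae_norm_le μ φ))

/-- The translated pairing `x ↦ ∫ g(y) φ(x⁻¹ y) dy` is continuous. -/
theorem continuous_integral_smul_comp (g : Lp ℝ 1 μ) (φ : Lp ℂ ∞ μ) :
    Continuous fun x : G => ∫ y, g y • φ (x⁻¹ * y) ∂μ := by
  -- The function factors through `L¹`: translation is continuous from `G` to `L¹`, and pairing with
  -- `φ` is Lipschitz on `L¹`.
  have hT : Continuous fun y : G =>
      (Lp.compMeasurePreserving (fun z => y * z) (measurePreserving_mul_left μ y) g : Lp ℝ 1 μ) := by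
    let h : C(G, C(G, G)) := (ContinuousMap.mk (fun a : G × G ↦ a.1 * a.2) continuous_mul).curry
    exact (continuous_const (y := g)).compMeasurePreservingLp (g := fun y => h y) h.continuous
      (fun y => measurePreserving_mul_left μ y) ENNReal.one_ne_top
  have hJ : Continuous fun h : Lp ℝ 1 μ => ∫ x, h x • φ x ∂μ := by
    have hi (h : Lp ℝ 1 μ) : Integrable (fun x => h x • φ x) μ := by
      simpa using integrable_smul_comp_mul_left μ h φ 1
    refine (LipschitzWith.of_dist_le_mul (K := ‖φ‖₊) fun h k => ?_).continuous
    rw [dist_eq_norm, dist_eq_norm, ← integral_sub (hi h) (hi k)]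
    refine le_trans (le_of_eq ?_) (norm_integral_smul_le μ (h - k) (ae_norm_le μ φ))
    congr 1
    refine integral_congr_ae ?_
    filter_upwards [Lp.coeFn_sub h k] with x hx
    rw [hx, Pi.sub_apply, sub_smul]
  refine (hJ.comp hT).congr fun x => ?_
  rw [Function.comp_apply, ← integral_mul_left_eq_self (fun y => g y • φ (x⁻¹ * y)) x]
  refine integral_congr_ae ?_
  filter_upwards [Lp.coeFn_compMeasurePreserving g (measurePreserving_mul_left μ x)] with y hy
  rw [hy]
  simp

/-- Fubini's theorem for `f(x) g(y) φ(x⁻¹ y)`, which need not be measurable for the product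
`σ`-algebra. -/
theorem integral_smul_convFun (f g : Lp ℝ 1 μ) (φ : Lp ℂ ∞ μ) :
    ∫ y, g y • convFun μ f φ y ∂μ = ∫ x, f x • ∫ y, g y • φ (x⁻¹ * y) ∂μ ∂μ := by
  have hbound (g : Lp ℝ 1 μ) (x : G) : ‖∫ y, g y • φ (x⁻¹ * y) ∂μ‖ ≤ ‖φ‖ * ‖g‖ :=
    norm_integral_smul_le μ g
      ((measurePreserving_mul_left μ x⁻¹).quasiMeasurePreserving.ae (ae_norm_le μ φ))
  have hiL (f g : Lp ℝ 1 μ) : Integrable (fun y => g y • convFun μ f φ y) μ :=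
    (L1.integrable_coeFn g).smul_bdd _
      (continuous_convFun μ f φ).measurable.aestronglyMeasurable
      (.of_forall (norm_convFun_le μ f φ))
  have hiR (f g : Lp ℝ 1 μ) : Integrable (fun x => f x • ∫ y, g y • φ (x⁻¹ * y) ∂μ) μ :=
    (L1.integrable_coeFn f).smul_bdd _
      (continuous_integral_smul_comp μ g φ).measurable.aestronglyMeasurable
      (.of_forall (hbound g))
  -- Both sides are Lipschitz in `f` and in `g` separately, so it suffices to compare them on the
  -- dense set of continuous functions of compact support.
  have hLf (g : Lp ℝ 1 μ) : Continuous fun f : Lp ℝ 1 μ => ∫ y, g y • convFun μ f φ y ∂μ := by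
    refine (LipschitzWith.of_dist_le_mul (K := ‖φ‖₊ * ‖g‖₊) fun h k => ?_).continuous
    rw [dist_eq_norm, dist_eq_norm, ← integral_sub (hiL h g) (hiL k g)]
    simp_rw [← smul_sub, ← convFun_sub_left]
    refine (norm_integral_smul_le μ g (.of_forall (norm_convFun_le μ (h - k) φ))).trans
      (le_of_eq ?_)
    simp only [NNReal.coe_mul, coe_nnnorm]
    ring
  have hRf (g : Lp ℝ 1 μ) :
      Continuous fun f : Lp ℝ 1 μ => ∫ x, f x • ∫ y, g y • φ (x⁻¹ * y) ∂μ ∂μ := by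
    refine (LipschitzWith.of_dist_le_mul (K := ‖φ‖₊ * ‖g‖₊) fun h k => ?_).continuous
    rw [dist_eq_norm, dist_eq_norm, ← integral_sub (hiR h g) (hiR k g)]
    refine le_trans (le_of_eq ?_) (norm_integral_smul_le μ (h - k) (.of_forall (hbound g)))
    congr 1
    refine integral_congr_ae ?_
    filter_upwards [Lp.coeFn_sub h k] with x hx
    rw [hx, Pi.sub_apply, sub_smul]
  have hLg (f : Lp ℝ 1 μ) : Continuous fun g : Lp ℝ 1 μ => ∫ y, g y • convFun μ f φ y ∂μ := by
    refine (LipschitzWith.of_dist_le_mul (K := ‖φ‖₊ * ‖f‖₊) fun h k => ?_).continuous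
    rw [dist_eq_norm, dist_eq_norm, ← integral_sub (hiL f h) (hiL f k)]
    refine le_trans (le_of_eq ?_)
      (norm_integral_smul_le μ (h - k) (.of_forall (norm_convFun_le μ f φ)))
    congr 1
    refine integral_congr_ae ?_
    filter_upwards [Lp.coeFn_sub h k] with x hx
    rw [hx, Pi.sub_apply, sub_smul]
  have hRg (f : Lp ℝ 1 μ) :
      Continuous fun g : Lp ℝ 1 μ => ∫ x, f x • ∫ y, g y • φ (x⁻¹ * y) ∂μ ∂μ := by
    refine (LipschitzWith.of_dist_le_mul (K := ‖φ‖₊ * ‖f‖₊) fun h k => ?_).continuous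
    rw [dist_eq_norm, dist_eq_norm, ← integral_sub (hiR f h) (hiR f k)]
    simp_rw [← smul_sub]
    have (x : G) : ∫ y, h y • φ (x⁻¹ * y) ∂μ - ∫ y, k y • φ (x⁻¹ * y) ∂μ =
        ∫ y, (h - k : Lp ℝ 1 μ) y • φ (x⁻¹ * y) ∂μ := by
      rw [← integral_sub (integrable_smul_comp_mul_left μ h φ _)
        (integrable_smul_comp_mul_left μ k φ _)]
      refine integral_congr_ae ?_
      filter_upwards [Lp.coeFn_sub h k] with x hx
      rw [hx, Pi.sub_apply, sub_smul]
    simp_rw [this]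
    refine (norm_integral_smul_le μ f (.of_forall (hbound (h - k)))).trans (le_of_eq ?_)
    simp only [NNReal.coe_mul, coe_nnnorm]
    ring
  refine congrFun ((hLf g).ext_on (dense_hasCompactSupport μ) (hRf g) ?_) f
  rintro f ⟨u, hu, hu', hfu⟩
  refine congrFun ((hLg f).ext_on (dense_hasCompactSupport μ) (hRg f) ?_) g
  rintro g ⟨v, hv, hv', hgv⟩
  have h1 (y : G) : convFun μ f φ y = ∫ x, u x • φ (x⁻¹ * y) ∂μ :=
    integral_congr_ae (hfu.mono fun x hx => by simp only [hx])
  have h2 (x : G) : ∫ y, g y • φ (x⁻¹ * y) ∂μ = ∫ y, v y • φ (x⁻¹ * y) ∂μ :=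
    integral_congr_ae (hgv.mono fun x hx => by simp only [hx])
  simp only [h1, h2]
  exact (integral_congr_ae (hgv.mono fun y hy => by simp only [hy])).trans
    ((fubini_of_hasCompactSupport μ hu hu' hv hv' φ).trans
      (integral_congr_ae (hfu.mono fun y hy => by simp only [hy])))

end Fubini

/-! ### The dual of `L¹` -/

section Dual

variable {α : Type*} [MeasurableSpace α] (μ : Measure α)

/-- A positive square-integrable weight on a `σ`-finite space. -/
theorem exists_pos_memLp_two [SigmaFinite μ] :
    ∃ w : α → ℝ, Measurable w ∧ (∀ x, 0 < w x) ∧ MemLp w 2 μ := by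
  obtain ⟨g, hg0, hgm, hg⟩ := exists_pos_lintegral_lt_of_sigmaFinite μ (ε := 1) one_ne_zero
  refine ⟨fun x => Real.sqrt (g x), by fun_prop, fun x => Real.sqrt_pos.2 (hg0 x), ?_⟩
  rw [memLp_two_iff_integrable_sq (by fun_prop)]
  simp only [Real.sq_sqrt (NNReal.coe_nonneg _)]
  refine ⟨by fun_prop, ?_⟩
  rw [hasFiniteIntegral_iff_ofReal (.of_forall fun x => NNReal.coe_nonneg _)]
  simpa using hg.trans ENNReal.one_lt_top

/-- Bounded functionals on `L¹` of a `σ`-finite space are given by bounded functions. -/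
theorem exists_forall_eq_integral_mul [SigmaFinite μ] (Λ : StrongDual ℝ (Lp ℝ 1 μ)) :
    ∃ h : α → ℝ, Measurable h ∧ (∀ᵐ x ∂μ, |h x| ≤ ‖Λ‖) ∧
      ∀ f : Lp ℝ 1 μ, Λ f = ∫ x, f x * h x ∂μ := by
  obtain ⟨w, hwm, hw0, hw⟩ := exists_pos_memLp_two μ
  -- Multiplication by `w` maps `L²` into `L¹`. The pullback of `Λ` is represented by some `p ∈ L²`,
  -- so the density of `Λ` must be `p / w`.
  let J : Lp ℝ 2 μ →L[ℝ] Lp ℝ 1 μ :=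
    (ContinuousLinearMap.mul ℝ ℝ).holderL μ 2 2 1 (hw.toLp w)
  let p : Lp ℝ 2 μ := (InnerProductSpace.toDual ℝ (Lp ℝ 2 μ)).symm (Λ.comp J)
  have hp {f : Lp ℝ 1 μ} {u : α → ℝ} (hu : MemLp u 2 μ) (hf : ∀ᵐ x ∂μ, f x = w x * u x) :
      Λ f = ∫ x, p x * u x ∂μ := by
    have h1 : J (hu.toLp u) = f := by
      refine Lp.ext ?_
      filter_upwards [ContinuousLinearMap.coeFn_holder (r := 1) (ContinuousLinearMap.mul ℝ ℝ)
        (hw.toLp w) (hu.toLp u), hw.coeFn_toLp, hu.coeFn_toLp, hf] with x h1 h2 h3 h4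
      rw [h4, ← h2, ← h3]
      exact h1
    have h2 : inner ℝ p (hu.toLp u) = Λ (J (hu.toLp u)) :=
      InnerProductSpace.toDual_symm_apply
    rw [← h1, ← h2, L2.inner_def]
    refine integral_congr_ae ?_
    filter_upwards [hu.coeFn_toLp] with x hx
    rw [hx]
    simp [mul_comm]
  have hpw : Integrable (fun x => p x * w x) μ := (Lp.memLp p).integrable_mul hw
  have hww : Integrable (fun x => w x ^ 2) μ := hw.integrable_sq
  -- Testing `Λ` on `1_E w²` compares `∫_E p w` with `‖Λ‖ ∫_E w²`; as `E` is arbitrary, `|p / w| ≤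
  -- ‖Λ‖` almost everywhere.
  have hset (E : Set α) (hE : MeasurableSet E) :
      |∫ x in E, p x * w x ∂μ| ≤ ‖Λ‖ * ∫ x in E, w x ^ 2 ∂μ := by
    have hu : MemLp (E.indicator w) 2 μ := hw.indicator hE
    have hf : MemLp (E.indicator fun x => w x ^ 2) 1 μ :=
      memLp_one_iff_integrable.2 (hww.indicator hE)
    have h1 := hp (f := hf.toLp _) hu (by
      filter_upwards [hf.coeFn_toLp] with x hx
      rw [hx]
      by_cases hxE : x ∈ E <;> simp [hxE, pow_two])
    have h2 : ∫ x in E, p x * w x ∂μ = Λ (hf.toLp _) := by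
      rw [h1, ← integral_indicator hE]
      congr 1 with x
      by_cases hxE : x ∈ E <;> simp [hxE]
    have h3 : ‖hf.toLp (E.indicator fun x => w x ^ 2)‖ = ∫ x in E, w x ^ 2 ∂μ := by
      rw [L1.norm_eq_integral_norm, ← integral_indicator hE]
      refine integral_congr_ae ?_
      filter_upwards [hf.coeFn_toLp] with x hx
      rw [hx]
      by_cases hxE : x ∈ E <;> simp [hxE]
    rw [h2, ← h3]
    exact Λ.le_opNorm _
  have hub : (fun x => p x * w x) ≤ᵐ[μ] fun x => ‖Λ‖ * w x ^ 2 := by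
    refine ae_le_of_forall_setIntegral_le hpw (hww.const_mul _) fun E hE _ => ?_
    rw [integral_const_mul]
    exact (le_abs_self _).trans (hset E hE)
  have hlb : (fun x => -(p x * w x)) ≤ᵐ[μ] fun x => ‖Λ‖ * w x ^ 2 := by
    refine ae_le_of_forall_setIntegral_le hpw.neg (hww.const_mul _) fun E hE _ => ?_
    rw [integral_const_mul, integral_neg]
    exact (neg_le_abs _).trans (hset E hE)
  have hhm : Measurable fun x => p x / w x := (Lp.stronglyMeasurable p).measurable.div hwm
  have hhb : ∀ᵐ x ∂μ, |p x / w x| ≤ ‖Λ‖ := by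
    filter_upwards [hub, hlb] with x h1 h2
    have hx := hw0 x
    rw [abs_div, abs_of_pos hx, div_le_iff₀ hx, ← mul_le_mul_iff_of_pos_right hx]
    have : |p x| * w x = |p x * w x| := by rw [abs_mul, abs_of_pos hx]
    rw [this, abs_le']
    constructor <;> linarith
  refine ⟨fun x => p x / w x, hhm, hhb, fun f => ?_⟩
  have hfi := L1.integrable_coeFn f
  have hfm : Measurable f := (Lp.stronglyMeasurable f).measurable
  -- On `E n` the quotient `f / w` is at most `n w` in absolute value, hence square-integrable, so
  -- the representation by `p` applies to the truncation. The sets `E n` exhaust the space because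
  -- `w > 0`.
  let E : ℕ → Set α := fun n => {x | |f x| ≤ n * w x ^ 2}
  have hE (n : ℕ) : MeasurableSet (E n) :=
    measurableSet_le (by fun_prop) (by fun_prop)
  have hEev (x : α) : ∀ᶠ n : ℕ in Filter.atTop, x ∈ E n := by
    have := (tendsto_natCast_atTop_atTop (R := ℝ)).atTop_mul_const (pow_pos (hw0 x) 2)
    exact this.eventually_ge_atTop _
  have hfn (n : ℕ) : MemLp ((E n).indicator f) 1 μ :=
    memLp_one_iff_integrable.2 (hfi.indicator (hE n))
  have hΛn (n : ℕ) : Λ ((hfn n).toLp _) = ∫ x, (E n).indicator f x * (p x / w x) ∂μ := by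
    have hu : MemLp (fun x => (E n).indicator f x / w x) 2 μ := by
      refine (hw.const_mul (n : ℝ)).mono
        ((hfm.indicator (hE n)).div hwm).aestronglyMeasurable (.of_forall fun x => ?_)
      have hx := hw0 x
      by_cases hxE : x ∈ E n
      · have : |f x| ≤ n * w x ^ 2 := hxE
        rw [indicator_of_mem hxE, norm_div, Real.norm_of_nonneg hx.le, div_le_iff₀ hx,
          Real.norm_of_nonneg (mul_nonneg n.cast_nonneg hx.le), Real.norm_eq_abs]
        linarith
      · rw [indicator_of_notMem hxE, zero_div, norm_zero]
        exact norm_nonneg _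
    rw [hp hu]
    · congr 1 with x
      have := (hw0 x).ne'
      field_simp
    · filter_upwards [(hfn n).coeFn_toLp] with x hx
      rw [hx, mul_div_cancel₀ _ (hw0 x).ne']
  have hlim1 : Filter.Tendsto (fun n => Λ ((hfn n).toLp _)) Filter.atTop (𝓝 (Λ f)) := by
    refine (Λ.continuous.tendsto f).comp ?_
    rw [tendsto_iff_norm_sub_tendsto_zero]
    have h0 (n : ℕ) : ‖(hfn n).toLp _ - f‖ = ∫ x, ‖(E n).indicator f x - f x‖ ∂μ := by
      rw [L1.norm_eq_integral_norm]
      refine integral_congr_ae ?_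
      filter_upwards [Lp.coeFn_sub ((hfn n).toLp _) f, (hfn n).coeFn_toLp] with x h1 h2
      rw [h1, Pi.sub_apply, h2]
    simp_rw [h0]
    rw [← integral_zero α ℝ (μ := μ)]
    refine tendsto_integral_of_dominated_convergence (fun x => ‖f x‖)
      (fun n => ((hfm.indicator (hE n)).sub hfm).norm.aestronglyMeasurable) hfi.norm
      (fun n => .of_forall fun x => ?_) (.of_forall fun x => ?_)
    · by_cases hxE : x ∈ E n <;> simp [hxE]
    · refine tendsto_const_nhds.congr' ?_
      filter_upwards [hEev x] with n hn
      simp [hn]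
  have hlim2 : Filter.Tendsto (fun n => ∫ x, (E n).indicator f x * (p x / w x) ∂μ) Filter.atTop
      (𝓝 (∫ x, f x * (p x / w x) ∂μ)) := by
    refine tendsto_integral_of_dominated_convergence (fun x => ‖f x‖ * ‖Λ‖)
      (fun n => ((hfm.indicator (hE n)).mul hhm).aestronglyMeasurable) (hfi.norm.mul_const _)
      (fun n => ?_) (.of_forall fun x => ?_)
    · filter_upwards [hhb] with x hx
      rw [norm_mul]
      refine mul_le_mul (norm_indicator_le_norm_self _ _) hx (norm_nonneg _) (norm_nonneg _)
    · refine tendsto_const_nhds.congr' ?_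
      filter_upwards [hEev x] with n hn
      rw [indicator_of_mem hn]
  simp_rw [hΛn] at hlim1
  exact tendsto_nhds_unique hlim1 hlim2

end Dual

/-! ### Positive functionals on `L∞` -/

section Means

variable {α : Type*} [MeasurableSpace α] {μ : Measure α}

theorem coeFn_ind {E : Set α} (hE : MeasurableSet E) :
    ind μ E hE =ᵐ[μ] E.indicator fun _ => (1 : ℂ) :=
  MemLp.coeFn_toLp _

variable {m : StrongDual ℂ (Lp ℂ ∞ μ)}

/-- Positivity of a functional on `L∞`. -/
def IsPositiveFunctional (m : StrongDual ℂ (Lp ℂ ∞ μ)) : Prop :=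
  ∀ φ : Lp ℂ ∞ μ, (∀ᵐ x ∂μ, 0 ≤ φ x) → 0 ≤ m φ

/-- The constant function `1` in `L∞`. -/
noncomputable def one (μ : Measure α) : Lp ℂ ∞ μ :=
  (memLp_top_const (1 : ℂ)).toLp fun _ => (1 : ℂ)

theorem coeFn_one : one μ =ᵐ[μ] fun _ => (1 : ℂ) :=
  MemLp.coeFn_toLp _

/-- The real part of an element of `L∞`, as a complex-valued function. -/
noncomputable def rePart (φ : Lp ℂ ∞ μ) : Lp ℂ ∞ μ :=
  (Lp.memLp φ).re.ofReal.toLp fun x => ((RCLike.re (φ x) : ℝ) : ℂ)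

theorem coeFn_rePart (φ : Lp ℂ ∞ μ) : rePart φ =ᵐ[μ] fun x => ((φ x).re : ℂ) :=
  MemLp.coeFn_toLp _

/-- The imaginary part of an element of `L∞`, as a complex-valued function. -/
noncomputable def imPart (φ : Lp ℂ ∞ μ) : Lp ℂ ∞ μ :=
  (Lp.memLp φ).im.ofReal.toLp fun x => ((RCLike.im (φ x) : ℝ) : ℂ)

theorem coeFn_imPart (φ : Lp ℂ ∞ μ) : imPart φ =ᵐ[μ] fun x => ((φ x).im : ℂ) :=
  MemLp.coeFn_toLp _

theorem rePart_add_imPart (φ : Lp ℂ ∞ μ) : rePart φ + Complex.I • imPart φ = φ := by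
  refine Lp.ext ?_
  filter_upwards [Lp.coeFn_add (rePart φ) (Complex.I • imPart φ),
    Lp.coeFn_smul Complex.I (imPart φ), coeFn_rePart φ, coeFn_imPart φ] with x h1 h2 h3 h4
  rw [h1, Pi.add_apply, h2, Pi.smul_apply, h3, h4, smul_eq_mul, mul_comm]
  exact Complex.re_add_im _

theorem apply_one_nonneg (hm : IsPositiveFunctional m) : 0 ≤ m (one μ) :=
  hm _ (coeFn_one.mono fun x hx => by rw [hx]; exact zero_le_one)

/-- A positive functional is real on real-valued functions, and bounded there by its value
at `1`. -/
theorem apply_real_bounds (hm : IsPositiveFunctional m) {φ : Lp ℂ ∞ μ} {u : ℝ} (h : ∀ᵐ x ∂μ, ∃ r : ℝ, φ x = r ∧ u ≤ r) :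
    (m φ).im = 0 ∧ u * (m (one μ)).re ≤ (m φ).re := by
  have h1 : 0 ≤ m (φ - (u : ℂ) • one μ) := by
    refine hm _ ?_
    filter_upwards [h, coeFn_one (μ := μ), Lp.coeFn_sub φ ((u : ℂ) • one μ),
      Lp.coeFn_smul (u : ℂ) (one μ)] with x ⟨r, hr, hur⟩ h1 h2 h3
    rw [h2, Pi.sub_apply, h3, Pi.smul_apply, h1, hr, smul_eq_mul, mul_one, ← Complex.ofReal_sub]
    exact_mod_cast sub_nonneg.2 hur
  rw [map_sub, map_smul, smul_eq_mul] at h1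
  have h2 := apply_one_nonneg hm
  rw [Complex.nonneg_iff] at h1 h2
  simp only [Complex.sub_re, Complex.sub_im, Complex.mul_re, Complex.mul_im, Complex.ofReal_re,
    Complex.ofReal_im, ← h2.2, mul_zero, zero_mul, sub_zero, add_zero] at h1
  exact ⟨h1.2.symm, by linarith [h1.1]⟩

theorem real_bound {φ ψ : Lp ℂ ∞ μ} {f : α → ℝ} (h : ψ =ᵐ[μ] fun x => (f x : ℂ))
    (hf : ∀ x, |f x| ≤ ‖φ x‖) : ∀ᵐ x ∂μ, ∃ r : ℝ, ψ x = r ∧ -‖φ‖ ≤ r := by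
  filter_upwards [h, ae_norm_le μ φ] with x h1 h2
  exact ⟨f x, h1, (abs_le.1 ((hf x).trans h2)).1⟩

theorem im_apply_imPart (hm : IsPositiveFunctional m) (φ : Lp ℂ ∞ μ) : (m (imPart φ)).im = 0 :=
  (apply_real_bounds hm (real_bound (coeFn_imPart φ) fun _ => Complex.abs_im_le_norm _)).1

theorem re_apply_eq (hm : IsPositiveFunctional m) (φ : Lp ℂ ∞ μ) : (m φ).re = (m (rePart φ)).re := by
  conv_lhs => rw [← rePart_add_imPart φ]
  simp [im_apply_imPart hm φ]

theorem mul_re_apply_one_le (hm : IsPositiveFunctional m) {φ : Lp ℂ ∞ μ} {u : ℝ} (h : ∀ᵐ x ∂μ, u ≤ (φ x).re) :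
    u * (m (one μ)).re ≤ (m φ).re := by
  rw [re_apply_eq hm φ]
  refine (apply_real_bounds hm ?_).2
  filter_upwards [h, coeFn_rePart φ] with x h1 h2
  exact ⟨_, h2, h1⟩

theorem re_apply_le_mul (hm : IsPositiveFunctional m) {φ : Lp ℂ ∞ μ} {u : ℝ} (h : ∀ᵐ x ∂μ, (φ x).re ≤ u) :
    (m φ).re ≤ u * (m (one μ)).re := by
  have h1 := mul_re_apply_one_le hm (φ := -φ) (u := -u) (by
    filter_upwards [h, Lp.coeFn_neg φ] with x h1 h2
    rw [h2, Pi.neg_apply, Complex.neg_re]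
    linarith)
  rw [map_neg, Complex.neg_re] at h1
  linarith

/-- Positivity bounds `|Re m(φ)|` by `‖φ‖ Re m(1)`. If `Re m(1)` were zero, so would be `Re m`, and
also `Im m` by passing to `-iφ`, contradicting norm one. -/
theorem re_apply_one_pos (hm : m ∈ Means μ) : 0 < (m (one μ)).re := by
  refine (Complex.nonneg_iff.1 (apply_one_nonneg hm.2)).1.lt_of_ne fun h0 => ?_
  have hz (φ : Lp ℂ ∞ μ) : (m φ).re = 0 := by
    refine le_antisymm ?_ ?_
    · refine (re_apply_le_mul hm.2 (u := ‖φ‖) ?_).trans (by rw [← h0, mul_zero])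
      filter_upwards [ae_norm_le μ φ] with x hx
      exact (Complex.re_le_norm _).trans hx
    · refine le_trans (by rw [← h0, mul_zero]) (mul_re_apply_one_le hm.2 (u := -‖φ‖) ?_)
      filter_upwards [ae_norm_le μ φ] with x hx
      exact (abs_le.1 ((Complex.abs_re_le_norm _).trans hx)).1
  have hm0 : m = 0 := by
    ext φ
    refine Complex.ext (hz φ) ?_
    have := hz (-Complex.I • φ)
    simpa using this
  have := hm.1
  rw [hm0, norm_zero] at this
  exact zero_ne_one this

end Means

/-! ### Convolution and left-invariant means -/

section Conv

variable {G : Type*} [Group G] [TopologicalSpace G] [IsTopologicalGroup G]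
  [LocallyCompactSpace G] [T2Space G] [SigmaCompactSpace G] [MeasurableSpace G] [BorelSpace G]
  (μ : Measure G) [μ.IsHaarMeasure] [μ.Regular]

/-- Left translation on `L¹(G)`, as a linear isometry. -/
noncomputable def translate (x : G) : Lp ℝ 1 μ →ₗᵢ[ℝ] Lp ℝ 1 μ :=
  Lp.compMeasurePreservingₗᵢ ℝ (fun y => x⁻¹ * y) (measurePreserving_mul_left μ x⁻¹)

theorem coeFn_translate (x : G) (f : Lp ℝ 1 μ) :
    translate μ x f =ᵐ[μ] fun y => f (x⁻¹ * y) :=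
  Lp.coeFn_compMeasurePreserving f (measurePreserving_mul_left μ x⁻¹)

theorem coeFn_conv (f : Lp ℝ 1 μ) (φ : Lp ℂ ∞ μ) : conv μ f φ =ᵐ[μ] convFun μ f φ :=
  MemLp.coeFn_toLp _

theorem coeFn_leftTranslate (x : G) (φ : Lp ℂ ∞ μ) :
    leftTranslate μ x φ =ᵐ[μ] fun y => φ (x⁻¹ * y) :=
  Lp.coeFn_compMeasurePreserving φ (measurePreserving_mul_left μ x⁻¹)

theorem convFun_translate (x : G) (f : Lp ℝ 1 μ) (φ : Lp ℂ ∞ μ) (y : G) :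
    convFun μ (translate μ x f) φ y = convFun μ f φ (x⁻¹ * y) := by
  rw [convFun, convFun, ← integral_mul_left_eq_self (fun z => f z • φ (z⁻¹ * (x⁻¹ * y))) x⁻¹]
  refine integral_congr_ae ?_
  filter_upwards [coeFn_translate μ x f] with z hz
  rw [hz]
  simp [mul_assoc]

theorem conv_translate (x : G) (f : Lp ℝ 1 μ) (φ : Lp ℂ ∞ μ) :
    conv μ (translate μ x f) φ = leftTranslate μ x (conv μ f φ) := by
  refine Lp.ext ?_
  filter_upwards [coeFn_conv μ (translate μ x f) φ, coeFn_leftTranslate μ x (conv μ f φ),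
    (measurePreserving_mul_left μ x⁻¹).quasiMeasurePreserving.ae (coeFn_conv μ f φ)]
    with y h1 h2 h3
  rw [h1, h2, h3, convFun_translate]

theorem norm_conv_le (f : Lp ℝ 1 μ) (φ : Lp ℂ ∞ μ) : ‖conv μ f φ‖ ≤ ‖φ‖ * ‖f‖ := by
  rw [conv, Lp.norm_toLp, eLpNorm_exponent_top]
  exact ENNReal.toReal_le_of_le_ofReal (by positivity)
    (eLpNormEssSup_le_of_ae_bound (.of_forall (norm_convFun_le μ f φ)))

/-- Convolution with a fixed bounded function, as a linear map. -/
noncomputable def convLinear (φ : Lp ℂ ∞ μ) : Lp ℝ 1 μ →ₗ[ℝ] Lp ℂ ∞ μ where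
  toFun f := conv μ f φ
  map_add' f g := by
    refine Lp.ext ?_
    filter_upwards [coeFn_conv μ (f + g) φ, coeFn_conv μ f φ, coeFn_conv μ g φ,
      Lp.coeFn_add (conv μ f φ) (conv μ g φ)] with y h1 h2 h3 h4
    rw [h1, h4, Pi.add_apply, h2, h3, convFun, convFun, convFun,
      ← integral_add (integrable_smul_comp_inv_mul μ f φ y) (integrable_smul_comp_inv_mul μ g φ y)]
    refine integral_congr_ae ?_
    filter_upwards [Lp.coeFn_add f g] with x hx
    rw [hx, Pi.add_apply, add_smul]
  map_smul' c f := by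
    refine Lp.ext ?_
    filter_upwards [coeFn_conv μ (c • f) φ, coeFn_conv μ f φ,
      Lp.coeFn_smul c (conv μ f φ)] with y h1 h2 h3
    rw [RingHom.id_apply, h1, h3, Pi.smul_apply, h2, convFun, convFun, ← integral_smul]
    refine integral_congr_ae ?_
    filter_upwards [Lp.coeFn_smul c f] with x hx
    rw [hx, Pi.smul_apply, smul_assoc]

/-- A functional on `L¹(G)` invariant under left translations is a multiple of the integral. -/
theorem exists_eq_mul_integral_of_translate (Λ : StrongDual ℝ (Lp ℝ 1 μ))
    (hΛ : ∀ x f, Λ (translate μ x f) = Λ f) : ∃ k : ℝ, ∀ f, Λ f = k * ∫ x, f x ∂μ := by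
  obtain ⟨h, hmeas, hbound, hrep⟩ := exists_forall_eq_integral_mul μ Λ
  -- Testing on indicator functions turns the invariance of `Λ` into that of its density, up to a
  -- null set depending on `x`.
  have hinv (x : G) : (fun y => h (x * y)) =ᵐ[μ] h := by
    have hb1 : ∀ᵐ y ∂μ, |h (x * y)| ≤ ‖Λ‖ :=
      (measurePreserving_mul_left μ x).quasiMeasurePreserving.ae hbound
    refine ae_eq_of_forall_setIntegral_eq_of_sigmaFinite
      (fun s hs hμs => Measure.integrableOn_of_bounded hμs.ne
        (hmeas.comp (measurable_const_mul x)).aestronglyMeasurable (ae_restrict_of_ae hb1))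
      (fun s hs hμs => Measure.integrableOn_of_bounded hμs.ne
        hmeas.aestronglyMeasurable (ae_restrict_of_ae hbound)) fun s hs hμs => ?_
    let f : Lp ℝ 1 μ := indicatorConstLp 1 hs hμs.ne (1 : ℝ)
    have hf : f =ᵐ[μ] s.indicator fun _ => 1 := indicatorConstLp_coeFn
    have h1 : Λ f = ∫ y in s, h y ∂μ := by
      rw [hrep, ← integral_indicator hs]
      refine integral_congr_ae ?_
      filter_upwards [hf] with y hy
      rw [hy]
      by_cases hys : y ∈ s <;> simp [hys]
    rw [← h1, ← hΛ x f, hrep, ← integral_indicator hs,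
      ← integral_mul_left_eq_self (fun y => (translate μ x f) y * h y) x]
    refine integral_congr_ae ?_
    filter_upwards [hf, (measurePreserving_mul_left μ x).quasiMeasurePreserving.ae
      (coeFn_translate μ x f)] with y h1 h2
    rw [h2, inv_mul_cancel_left, h1]
    by_cases hys : y ∈ s <;> simp [hys]
  set C := ‖Λ‖
  -- Adding `C = ‖Λ‖` makes the density nonnegative, so it defines a left-invariant measure.
  -- Uniqueness of Haar measure then forces it to be constant almost everywhere, which removes the
  -- dependence of the null sets on `x`.
  set d : G → ℝ≥0∞ := fun y => ENNReal.ofReal (h y + C) with hd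
  have hdm : Measurable d := by fun_prop
  set ν := μ.withDensity d
  have : ν.IsMulLeftInvariant := by
    rw [← forall_measure_preimage_mul_iff]
    intro g A hA
    have hgA : MeasurableSet ((fun h => g * h) ⁻¹' A) := measurable_const_mul g hA
    rw [withDensity_apply _ hA, withDensity_apply _ hgA, ← lintegral_indicator hA,
      ← lintegral_indicator hgA, ← lintegral_mul_left_eq_self (A.indicator d) g]
    refine lintegral_congr_ae ?_
    filter_upwards [hinv g] with y hy
    by_cases hyA : g * y ∈ A
    · rw [indicator_of_mem hyA, indicator_of_mem (s := (fun h => g * h) ⁻¹' A) hyA]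
      simp only [hd, hy]
    · rw [indicator_of_notMem hyA, indicator_of_notMem (s := (fun h => g * h) ⁻¹' A) hyA]
  have : IsFiniteMeasureOnCompacts ν := by
    refine ⟨fun K hK => ?_⟩
    rw [withDensity_apply _ hK.measurableSet]
    refine (setLIntegral_mono_ae (g := fun _ => ENNReal.ofReal (C + C)) measurable_const.aemeasurable
      (hbound.mono fun x hx _ => ENNReal.ofReal_le_ofReal ?_)).trans_lt ?_
    · linarith [le_abs_self (h x)]
    · rw [setLIntegral_const]
      exact ENNReal.mul_lt_top ENNReal.ofReal_lt_top hK.measure_lt_top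
  obtain ⟨c, hc⟩ := exists_eq_smul_of_isMulLeftInvariant ν μ
  have hdc : d =ᵐ[μ] fun _ => (c : ℝ≥0∞) := by
    rw [← withDensity_eq_iff_of_sigmaFinite hdm.aemeasurable aemeasurable_const, withDensity_const]
    exact hc
  refine ⟨c - C, fun f => ?_⟩
  rw [hrep, ← integral_const_mul]
  refine integral_congr_ae ?_
  filter_upwards [hdc, hbound] with x h1 h2
  have h3 : 0 ≤ h x + C := by linarith [neg_abs_le (h x)]
  have h4 := congrArg ENNReal.toReal h1
  rw [hd, ENNReal.toReal_ofReal h3, ENNReal.coe_toReal] at h4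
  rw [← h4]
  ring

/-- A left-invariant mean takes the same value on all `f * φ` with `f ∈ P₁(G)`. -/
theorem re_apply_conv_eq {m : StrongDual ℂ (Lp ℂ ∞ μ)} (hm : m ∈ LIM μ) {f g : Lp ℝ 1 μ}
    (hfg : ∫ x, f x ∂μ = ∫ x, g x ∂μ) (φ : Lp ℂ ∞ μ) :
    (m (conv μ f φ)).re = (m (conv μ g φ)).re := by
  -- Convolution intertwines translation of `f` with translation of `f * φ`, so invariance of `m`
  -- makes this functional translation-invariant, hence a multiple of the integral.
  let Λ : StrongDual ℝ (Lp ℝ 1 μ) :=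
    LinearMap.mkContinuous
      (Complex.reLm ∘ₗ (m : Lp ℂ ∞ μ →ₗ[ℂ] ℂ).restrictScalars ℝ ∘ₗ convLinear μ φ)
      (‖m‖ * ‖φ‖) fun f => by
        refine (Complex.abs_re_le_norm _).trans ((m.le_opNorm _).trans ?_)
        rw [mul_assoc]
        gcongr
        exact norm_conv_le μ f φ
  obtain ⟨k, hk⟩ := exists_eq_mul_integral_of_translate μ Λ fun x f => by
    change (m (conv μ (translate μ x f) φ)).re = (m (conv μ f φ)).re
    rw [conv_translate, ← hm.2]
  exact (hk f).trans ((congrArg (k * ·) hfg).trans (hk g).symm)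

end Conv

/-! ### Convolution on `L¹` and its adjoint -/

section Reiter

variable {G : Type*} [Group G] [TopologicalSpace G] [IsTopologicalGroup G]
  [LocallyCompactSpace G] [T2Space G] [SigmaCompactSpace G] [MeasurableSpace G] [BorelSpace G]

/-- By `σ`-compactness the range is a countable union of compact sets, hence separable. This allows
Bochner integration of `x ↦ l_x g` in `L¹`. -/
theorem stronglyMeasurable_of_continuous {E : Type*} [NormedAddCommGroup E] {F : G → E}
    (hF : Continuous F) : StronglyMeasurable F := by
  borelize E
  refine stronglyMeasurable_iff_measurable_separable.2 ⟨hF.measurable, ?_⟩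
  rw [← image_univ, ← iUnion_compactCovering, image_iUnion]
  exact TopologicalSpace.IsSeparable.iUnion fun n =>
    ((isCompact_compactCovering G n).image hF).isSeparable

variable (μ : Measure G) [μ.IsHaarMeasure] [μ.Regular]

theorem continuous_translate (f : Lp ℝ 1 μ) : Continuous fun x => translate μ x f := by
  let g : C(G, C(G, G)) :=
    (ContinuousMap.mk (fun a : G × G ↦ a.1⁻¹ * a.2) (by fun_prop)).curry
  exact (continuous_const (y := f)).compMeasurePreservingLp (g := fun x => g x) g.continuous
    (fun x => measurePreserving_mul_left μ x⁻¹) ENNReal.one_ne_top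

theorem translate_mul (x y : G) (f : Lp ℝ 1 μ) :
    translate μ (x * y) f = translate μ x (translate μ y f) := by
  refine Lp.ext ?_
  filter_upwards [coeFn_translate μ (x * y) f, coeFn_translate μ x (translate μ y f),
    (measurePreserving_mul_left μ x⁻¹).quasiMeasurePreserving.ae (coeFn_translate μ y f)]
    with z h1 h2 h3
  rw [h1, h2, h3]
  simp [mul_assoc]

theorem integral_translate (x : G) (f : Lp ℝ 1 μ) :
    ∫ y, translate μ x f y ∂μ = ∫ y, f y ∂μ := by
  rw [integral_congr_ae (coeFn_translate μ x f)]
  exact integral_mul_left_eq_self (fun y => f y) x⁻¹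

theorem mem_P₁_iff {f : Lp ℝ 1 μ} : f ∈ P₁ μ ↔ 0 ≤ f ∧ ∫ x, f x ∂μ = 1 := by
  refine and_congr_right fun h => ?_
  rw [L1.norm_eq_integral_norm]
  refine Eq.congr_left (integral_congr_ae ?_)
  filter_upwards [(Lp.coeFn_nonneg f).2 h] with x hx
  exact Real.norm_of_nonneg hx

theorem translate_mem_P₁ {f : Lp ℝ 1 μ} (hf : f ∈ P₁ μ) (x : G) : translate μ x f ∈ P₁ μ := by
  refine ⟨?_, by rw [LinearIsometry.norm_map]; exact hf.2⟩
  rw [← Lp.coeFn_nonneg]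
  filter_upwards [coeFn_translate μ x f, (measurePreserving_mul_left μ x⁻¹).quasiMeasurePreserving.ae
    ((Lp.coeFn_nonneg f).2 hf.1)] with y h1 h2
  rw [h1]
  exact h2

theorem integrable_smul_translate (f g : Lp ℝ 1 μ) :
    Integrable (fun x => f x • translate μ x g) μ :=
  (L1.integrable_coeFn f).smul_bdd ‖g‖
    (stronglyMeasurable_of_continuous (continuous_translate μ g)).aestronglyMeasurable
    (.of_forall fun x => by rw [LinearIsometry.norm_map])

/-- Convolution `g ↦ f * g = ∫ f(x) l_x g dx` on `L¹(G)`. -/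
noncomputable def lconv (f : Lp ℝ 1 μ) : Lp ℝ 1 μ →L[ℝ] Lp ℝ 1 μ :=
  LinearMap.mkContinuous
    { toFun g := ∫ x, f x • translate μ x g ∂μ
      map_add' g h := by
        rw [← integral_add (integrable_smul_translate μ f g) (integrable_smul_translate μ f h)]
        simp
      map_smul' c g := by
        rw [RingHom.id_apply, ← integral_smul]
        simp [smul_comm c] } ‖f‖ fun g => by
    rw [L1.norm_eq_integral_norm f, ← integral_mul_const]
    refine norm_integral_le_of_norm_le ((L1.integrable_coeFn f).norm.mul_const _)
      (.of_forall fun x => ?_)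
    rw [norm_smul, LinearIsometry.norm_map]

theorem lconv_apply (f g : Lp ℝ 1 μ) : lconv μ f g = ∫ x, f x • translate μ x g ∂μ := rfl

theorem norm_lconv_apply_le (f g : Lp ℝ 1 μ) : ‖lconv μ f g‖ ≤ ‖f‖ * ‖g‖ :=
  LinearMap.mkContinuous_norm_le _ (norm_nonneg f) _ |> (lconv μ f).le_of_opNorm_le <| g

theorem lconv_sub_left (f f' g : Lp ℝ 1 μ) :
    lconv μ (f - f') g = lconv μ f g - lconv μ f' g := by
  rw [lconv_apply, lconv_apply, lconv_apply, ← integral_sub (integrable_smul_translate μ f g)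
    (integrable_smul_translate μ f' g)]
  refine integral_congr_ae ?_
  filter_upwards [Lp.coeFn_sub f f'] with x hx
  rw [hx, Pi.sub_apply, sub_smul]

theorem translate_lconv (z : G) (f g : Lp ℝ 1 μ) :
    translate μ z (lconv μ f g) = lconv μ (translate μ z f) g := by
  rw [lconv_apply, lconv_apply]
  have h := ContinuousLinearMap.integral_comp_comm (translate μ z).toContinuousLinearMap
    (integrable_smul_translate μ f g)
  simp only [LinearIsometry.coe_toContinuousLinearMap, map_smul] at h
  rw [← h, ← integral_mul_left_eq_self (fun x => translate μ z f x • translate μ x g) z]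
  refine integral_congr_ae ?_
  filter_upwards [(measurePreserving_mul_left μ z).quasiMeasurePreserving.ae
    (coeFn_translate μ z f)] with x hx
  rw [hx, inv_mul_cancel_left, translate_mul]

theorem lconv_mem_P₁ {f g : Lp ℝ 1 μ} (hf : f ∈ P₁ μ) (hg : g ∈ P₁ μ) : lconv μ f g ∈ P₁ μ := by
  rw [mem_P₁_iff]
  constructor
  · rw [lconv_apply]
    have : IsOrderedModule ℝ (Lp ℝ 1 μ) := .of_smul_nonneg fun c hc f hf => by
      rw [← Lp.coeFn_nonneg] at hf ⊢
      filter_upwards [hf, Lp.coeFn_smul c f] with x h1 h2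
      rw [h2]
      exact mul_nonneg hc h1
    refine integral_nonneg_of_ae ?_
    filter_upwards [(Lp.coeFn_nonneg f).2 hf.1] with x hx
    exact smul_nonneg hx (translate_mem_P₁ μ hg x).1
  · have h := ContinuousLinearMap.integral_comp_comm
      (L1.integralCLM (α := G) (E := ℝ) (μ := μ)) (integrable_smul_translate μ f g)
    rw [← lconv_apply] at h
    have h2 (k : Lp ℝ 1 μ) : L1.integralCLM k = ∫ x, k x ∂μ := by
      rw [← L1.integral_eq_integral, L1.integral_eq]
    have h3 (x : G) : L1.integralCLM (f x • translate μ x g) = f x := by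
      rw [map_smul, h2, integral_translate, ((mem_P₁_iff μ).1 hg).2, smul_eq_mul, mul_one]
    rw [← h2, ← h, ← ((mem_P₁_iff μ).1 hf).2]
    exact integral_congr_ae (.of_forall h3)

/-- The involution of `L¹(G)`, dual to inversion. -/
theorem exists_involution {f : Lp ℝ 1 μ} (hf : f ∈ P₁ μ) :
    ∃ f' ∈ P₁ μ, ∀ k : G → ℂ, ∫ x, f' x • k x⁻¹ ∂μ = ∫ x, f x • k x ∂μ := by
  have hcm := (continuous_modularCharacter (G := G)).measurable
  have hint : Integrable (fun x => (modularCharacter x : ℝ) * f x⁻¹) μ := by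
    have h1 : Integrable f (map (MeasurableEquiv.inv G)
        (μ.withDensity fun x => (modularCharacter x : ℝ≥0∞))) := by
      have := map_inv_withDensity_modularCharacter μ
      change Integrable f (map Inv.inv _)
      rw [this]
      exact L1.integrable_coeFn f
    rw [integrable_map_equiv, integrable_withDensity_iff_integrable_smul hcm] at h1
    exact h1
  have hl : MemLp (fun x => (modularCharacter x : ℝ) * f x⁻¹) 1 μ :=
    memLp_one_iff_integrable.2 hint
  have hinv : ∀ᵐ x ∂μ, 0 ≤ f x⁻¹ := by
    simpa using ae_comp_inv_mul μ ((Lp.coeFn_nonneg f).2 hf.1) 1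
  refine ⟨hl.toLp _, (mem_P₁_iff μ).2 ⟨?_, ?_⟩, fun k => ?_⟩
  · rw [← Lp.coeFn_nonneg]
    filter_upwards [hl.coeFn_toLp, hinv] with x h1 h2
    rw [h1]
    exact mul_nonneg (NNReal.coe_nonneg _) h2
  · rw [integral_congr_ae hl.coeFn_toLp, ← ((mem_P₁_iff μ).1 hf).2]
    exact integral_modularCharacter_smul_comp_inv μ f
  · rw [← integral_modularCharacter_smul_comp_inv μ fun x => f x • k x]
    refine integral_congr_ae ?_
    filter_upwards [hl.coeFn_toLp] with x hx
    rw [hx, mul_smul]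
    rfl

/-- Every functional on `L¹(G)` is given by some `φ ∈ L∞(G)`. -/
theorem exists_eq_re_integral (Λ : StrongDual ℝ (Lp ℝ 1 μ)) :
    ∃ φ : Lp ℂ ∞ μ, ∀ f : Lp ℝ 1 μ, Λ f = (∫ x, f x • φ x ∂μ).re := by
  obtain ⟨h, hmeas, hbound, hrep⟩ := exists_forall_eq_integral_mul μ Λ
  have hl : MemLp (fun x => (h x : ℂ)) ∞ μ :=
    memLp_top_of_bound (by fun_prop) ‖Λ‖ (by simpa using hbound)
  refine ⟨hl.toLp _, fun f => ?_⟩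
  have h1 : ∫ x, f x • hl.toLp (fun x => (h x : ℂ)) x ∂μ = ∫ x, ((f x * h x : ℝ) : ℂ) ∂μ := by
    refine integral_congr_ae ?_
    filter_upwards [hl.coeFn_toLp] with x hx
    rw [hx]
    simp
  rw [h1, integral_complex_ofReal, Complex.ofReal_re, hrep]

theorem integral_lconv_smul (f g : Lp ℝ 1 μ) (φ : Lp ℂ ∞ μ) :
    ∫ y, lconv μ f g y • φ y ∂μ = ∫ x, f x • ∫ y, g y • φ (x * y) ∂μ ∂μ := by
  have hi (h : Lp ℝ 1 μ) : Integrable (fun x => h x • φ x) μ := by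
    simpa using integrable_smul_comp_mul_left μ h φ 1
  -- Pairing with `φ` is bounded and linear, so it passes under the Bochner integral defining `f *
  -- g`; no further appeal to Fubini is needed.
  let Φ : Lp ℝ 1 μ →L[ℝ] ℂ :=
    LinearMap.mkContinuous
      { toFun h := ∫ y, h y • φ y ∂μ
        map_add' h k := by
          rw [← integral_add (hi h) (hi k)]
          refine integral_congr_ae ?_
          filter_upwards [Lp.coeFn_add h k] with x hx
          rw [hx, Pi.add_apply, add_smul]
        map_smul' c h := by
          rw [RingHom.id_apply, ← integral_smul]
          refine integral_congr_ae ?_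
          filter_upwards [Lp.coeFn_smul c h] with x hx
          rw [hx, Pi.smul_apply, smul_assoc] }
      ‖φ‖ fun h => norm_integral_smul_le μ h (ae_norm_le μ φ)
  have h := Φ.integral_comp_comm (integrable_smul_translate μ f g)
  rw [← lconv_apply] at h
  change _ = ∫ y, lconv μ f g y • φ y ∂μ at h
  rw [← h]
  refine integral_congr_ae (.of_forall fun x => ?_)
  change Φ (f x • translate μ x g) = _
  rw [map_smul]
  congr 1
  change ∫ y, translate μ x g y • φ y ∂μ = _
  rw [← integral_mul_left_eq_self (fun y => translate μ x g y • φ y) x]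
  refine integral_congr_ae ?_
  filter_upwards [(measurePreserving_mul_left μ x).quasiMeasurePreserving.ae
    (coeFn_translate μ x g)] with y hy
  rw [hy, inv_mul_cancel_left]

/-- The adjoint of `g ↦ f * g` is convolution by the involution of `f`. -/
theorem exists_adjoint_lconv {f : Lp ℝ 1 μ} (hf : f ∈ P₁ μ) :
    ∃ f' ∈ P₁ μ, ∀ (g : Lp ℝ 1 μ) (φ : Lp ℂ ∞ μ),
      ∫ y, lconv μ f g y • φ y ∂μ = ∫ y, g y • conv μ f' φ y ∂μ := by
  obtain ⟨f', hf', h⟩ := exists_involution μ hf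
  refine ⟨f', hf', fun g φ => ?_⟩
  rw [integral_lconv_smul, ← h, ← integral_smul_convFun]
  refine integral_congr_ae ?_
  filter_upwards [coeFn_conv μ f' φ] with y hy
  rw [hy]

end Reiter

/-! ### Day's theorem and Reiter's condition -/

section Day

variable {G : Type*} [Group G] [TopologicalSpace G] [IsTopologicalGroup G]
  [LocallyCompactSpace G] [T2Space G] [SigmaCompactSpace G] [MeasurableSpace G] [BorelSpace G]
  (μ : Measure G) [μ.IsHaarMeasure] [μ.Regular]

/-- The normalized indicator function of a set of positive finite measure lies in `P₁`. -/
theorem exists_mem_P₁_eq_indicator {α : Type*} [MeasurableSpace α] (μ : Measure α) {E : Set α}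
    (hE : MeasurableSet E) (h0 : μ E ≠ 0) (h1 : μ E ≠ ∞) :
    ∃ f ∈ P₁ μ, f =ᵐ[μ] E.indicator fun _ => (μ.real E)⁻¹ := by
  have hpos : 0 < μ.real E := ENNReal.toReal_pos h0 h1
  refine ⟨indicatorConstLp 1 hE h1 (μ.real E)⁻¹, ⟨?_, ?_⟩, indicatorConstLp_coeFn⟩
  · rw [← Lp.coeFn_nonneg]
    filter_upwards [indicatorConstLp_coeFn (p := 1) (hs := hE) (hμs := h1)
      (c := (μ.real E)⁻¹)] with x hx
    rw [hx]
    exact indicator_nonneg (fun _ _ => by positivity) x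
  · rw [norm_indicatorConstLp one_ne_zero ENNReal.one_ne_top]
    simp [abs_of_pos hpos, hpos.ne']

theorem convex_P₁ : Convex ℝ (P₁ μ) := by
  intro f hf g hg a b ha hb hab
  rw [mem_P₁_iff] at *
  refine ⟨?_, ?_⟩
  · rw [← Lp.coeFn_nonneg]
    filter_upwards [(Lp.coeFn_nonneg f).2 hf.1, (Lp.coeFn_nonneg g).2 hg.1,
      Lp.coeFn_add (a • f) (b • g), Lp.coeFn_smul a f, Lp.coeFn_smul b g] with x h1 h2 h3 h4 h5
    rw [h3, Pi.add_apply, h4, h5]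
    exact add_nonneg (mul_nonneg ha h1) (mul_nonneg hb h2)
  · rw [← L1.integral_eq_integral, L1.integral_add, L1.integral_smul, L1.integral_smul,
      L1.integral_eq_integral, L1.integral_eq_integral, hf.2, hg.2]
    simpa using hab

/-- If all averages of `Re ψ` are at least `u`, then `u ≤ Re ψ` almost everywhere. -/
theorem ae_le_re_of_forall_P₁ {ψ : Lp ℂ ∞ μ} {u : ℝ}
    (h : ∀ g ∈ P₁ μ, u ≤ (∫ x, g x • ψ x ∂μ).re) : ∀ᵐ x ∂μ, u ≤ (ψ x).re := by
  have hint (s : Set G) (hs : μ s < ∞) : IntegrableOn ψ s μ :=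
    Measure.integrableOn_of_bounded hs.ne (Lp.aestronglyMeasurable ψ)
      (ae_restrict_of_ae (ae_norm_le μ ψ))
  have key : 0 ≤ᵐ[μ] fun x => (ψ x).re - u := by
    refine ae_nonneg_of_forall_setIntegral_nonneg_of_sigmaFinite
      (fun s hs hμs => (hint s hμs).re.sub (integrableOn_const hμs.ne)) fun s hs hμs => ?_
    have h1 : ∫ x in s, ((ψ x).re - u) ∂μ = (∫ x in s, ψ x ∂μ).re - μ.real s * u := by
      have h2 : ∫ x in s, (ψ x).re ∂μ = (∫ x in s, ψ x ∂μ).re := integral_re (hint s hμs)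
      have h3 : IntegrableOn (fun x => (ψ x).re) s μ := (hint s hμs).re
      rw [integral_sub h3 (integrableOn_const hμs.ne), setIntegral_const, smul_eq_mul, h2]
    rw [h1]
    by_cases h0 : μ s = 0
    · rw [Measure.restrict_eq_zero.2 h0, integral_zero_measure, measureReal_def, h0]
      simp
    obtain ⟨g, hg, hgs⟩ := exists_mem_P₁_eq_indicator μ hs h0 hμs.ne
    have hpos : 0 < μ.real s := ENNReal.toReal_pos h0 hμs.ne
    have h2 : ∫ x, g x • ψ x ∂μ = (μ.real s)⁻¹ • ∫ x in s, ψ x ∂μ := by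
      rw [← integral_smul, ← integral_indicator hs]
      refine integral_congr_ae ?_
      filter_upwards [hgs] with x hx
      rw [hx]
      by_cases hxs : x ∈ s <;> simp [hxs]
    have h3 := h g hg
    rw [h2, Complex.real_smul, Complex.re_ofReal_mul, ← div_eq_inv_mul, le_div_iff₀ hpos] at h3
    linarith
  exact key.mono fun x hx => sub_nonneg.1 hx

/-- Day's theorem: given `f ∈ P₁(G)` and finitely many `x`, some `g ∈ P₁(G)` makes all
`(l_x f) * g` close to `f * g` in norm. -/
theorem exists_norm_lconv_translate_sub_lt (hamen : IsAmenable μ) {f : Lp ℝ 1 μ} (hf : f ∈ P₁ μ)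
    (F : Finset G) {ε : ℝ} (hε : 0 < ε) :
    ∃ g ∈ P₁ μ, ∀ x ∈ F, ‖lconv μ (translate μ x f) g - lconv μ f g‖ < ε := by
  classical
  obtain ⟨m, hm⟩ := hamen
  -- If the claim fails, the convex set `T '' P₁` misses the `ε`-ball, and Hahn–Banach gives `Λ`
  -- with `Λ ∘ T ≥ u > 0` on `P₁`.
  let T : Lp ℝ 1 μ →L[ℝ] (F → Lp ℝ 1 μ) :=
    ContinuousLinearMap.pi fun x : F => lconv μ (translate μ x f) - lconv μ f
  by_contra! hne
  have hdisj : Disjoint (Metric.ball (0 : F → Lp ℝ 1 μ) ε) (T '' P₁ μ) := by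
    rw [disjoint_right]
    rintro _ ⟨g, hg, rfl⟩ hmem
    obtain ⟨x, hxF, hx⟩ := hne g hg
    rw [mem_ball_zero_iff, pi_norm_lt_iff hε] at hmem
    exact (hmem ⟨x, hxF⟩).not_ge hx
  obtain ⟨Λ, u, hu1, hu2⟩ := geometric_hahn_banach_open (convex_ball _ _) Metric.isOpen_ball
    ((convex_P₁ μ).is_linear_image T.isLinear) hdisj
  have hu0 : 0 < u := by simpa using hu1 0 (Metric.mem_ball_self hε)
  choose φ hφ using fun x : F => exists_eq_re_integral μ
    (Λ.comp (ContinuousLinearMap.single ℝ (fun _ : F => Lp ℝ 1 μ) x))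
  choose f' hf' hadj using fun x : F => exists_adjoint_lconv μ (translate_mem_P₁ μ hf (x : G))
  obtain ⟨f₀, hf₀, hadj₀⟩ := exists_adjoint_lconv μ hf
  -- By the adjoint formula, `Λ ∘ T` is the real part of the pairing with `ψ`, so `Re ψ ≥ u` almost
  -- everywhere. But `Re m` cannot distinguish convolutions of the same function by two elements of
  -- `P₁`, so `Re m(ψ) = 0`, a contradiction.
  let ψ : Lp ℂ ∞ μ := ∑ x : F, (conv μ (f' x) (φ x) - conv μ f₀ (φ x))
  have hi (h : Lp ℝ 1 μ) (χ : Lp ℂ ∞ μ) : Integrable (fun x => h x • χ x) μ := by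
    simpa using integrable_smul_comp_mul_left μ h χ 1
  have hψ (g : Lp ℝ 1 μ) : Λ (T g) = (∫ y, g y • ψ y ∂μ).re := by
    have h1 : Λ (T g) = ∑ x : F, Λ (Pi.single x (T g x)) := by
      rw [← _root_.map_sum, Finset.univ_sum_single]
    have h2 (x : F) : Λ (Pi.single x (T g x)) =
        (∫ y, g y • (conv μ (f' x) (φ x) - conv μ f₀ (φ x) : Lp ℂ ∞ μ) y ∂μ).re := by
      refine (hφ x (T g x)).trans ?_
      congr 1
      have h3 : ∫ y, T g x y • φ x y ∂μ = ∫ y, lconv μ (translate μ x f) g y • φ x y ∂μ -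
          ∫ y, lconv μ f g y • φ x y ∂μ := by
        rw [← integral_sub (hi _ _) (hi _ _)]
        refine integral_congr_ae ?_
        filter_upwards [Lp.coeFn_sub (lconv μ (translate μ x f) g) (lconv μ f g)] with y hy
        change (lconv μ (translate μ x f) g - lconv μ f g : Lp ℝ 1 μ) y • φ x y = _
        rw [hy, Pi.sub_apply, sub_smul]
      rw [h3, hadj, hadj₀, ← integral_sub (hi _ _) (hi _ _)]
      refine integral_congr_ae ?_
      filter_upwards [Lp.coeFn_sub (conv μ (f' x) (φ x)) (conv μ f₀ (φ x))] with y hy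
      rw [hy, Pi.sub_apply, smul_sub]
    rw [h1, Finset.sum_congr rfl fun x _ => h2 x, ← Complex.re_sum,
      ← integral_finsetSum _ fun x _ => hi _ _]
    congr 1
    refine integral_congr_ae ?_
    filter_upwards [Lp.coeFn_finsetSum Finset.univ fun x : F =>
      (conv μ (f' x) (φ x) - conv μ f₀ (φ x) : Lp ℂ ∞ μ)] with y hy
    rw [hy, Finset.sum_apply, Finset.smul_sum]
  have hge : ∀ᵐ x ∂μ, u ≤ (ψ x).re :=
    ae_le_re_of_forall_P₁ μ fun g hg => (hψ g).symm ▸ hu2 _ (mem_image_of_mem _ hg)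
  have h1 := mul_re_apply_one_le hm.1.2 hge
  have h2 : (m ψ).re = 0 := by
    rw [_root_.map_sum, Complex.re_sum]
    refine Finset.sum_eq_zero fun x _ => ?_
    rw [map_sub, Complex.sub_re, sub_eq_zero]
    exact re_apply_conv_eq μ hm
      ((((mem_P₁_iff μ).1 (hf' x)).2).trans ((mem_P₁_iff μ).1 hf₀).2.symm) _
  rw [h2] at h1
  exact (mul_pos hu0 (re_apply_one_pos hm.1)).not_ge h1

theorem nonempty_P₁ : (P₁ μ).Nonempty := by
  obtain ⟨K, hK, hK1⟩ := exists_compact_mem_nhds (1 : G)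
  obtain ⟨f, hf, -⟩ := exists_mem_P₁_eq_indicator μ hK.measurableSet
    (measure_pos_of_mem_nhds μ hK1).ne' hK.measure_lt_top.ne
  exact ⟨f, hf⟩

/-- Reiter's condition, uniformly on compact sets. -/
theorem exists_norm_translate_sub_lt (hamen : IsAmenable μ) {K : Set G} (hK : IsCompact K)
    {ε : ℝ} (hε : 0 < ε) : ∃ g ∈ P₁ μ, ∀ x ∈ K, ‖translate μ x g - g‖ < ε := by
  obtain ⟨f, hf⟩ := nonempty_P₁ μ
  -- Since `l_y(f * g) = (l_y f) * g` and `y ↦ l_y f` is norm continuous, finitely many translations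
  -- control all of `K`, independently of `g ∈ P₁`.
  obtain ⟨t, -, ht⟩ := hK.elim_nhds_subcover
    (fun x => {y | ‖translate μ y f - translate μ x f‖ < ε / 2}) fun x _ => by
      refine IsOpen.mem_nhds ?_ (by simpa using half_pos hε)
      exact isOpen_lt ((continuous_translate μ f).sub continuous_const).norm continuous_const
  obtain ⟨g, hg, hgt⟩ := exists_norm_lconv_translate_sub_lt μ hamen hf t (half_pos hε)
  refine ⟨lconv μ f g, lconv_mem_P₁ μ hf hg, fun y hy => ?_⟩
  obtain ⟨x, hx, hxy⟩ := mem_iUnion₂.1 (ht hy)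
  have h1 := norm_lconv_apply_le μ (translate μ y f - translate μ x f) g
  rw [hg.2, mul_one, lconv_sub_left] at h1
  rw [translate_lconv]
  calc ‖lconv μ (translate μ y f) g - lconv μ f g‖
      ≤ ‖lconv μ (translate μ y f) g - lconv μ (translate μ x f) g‖ +
        ‖lconv μ (translate μ x f) g - lconv μ f g‖ := norm_sub_le_norm_sub_add_norm_sub _ _ _
    _ < ε / 2 + ε / 2 := add_lt_add (h1.trans_lt hxy) (hgt x hx)
    _ = ε := add_halves ε

end Day

/-! ### Decomposition of a function into level sets -/

section Layers

variable {α : Type*} [MeasurableSpace α] (μ : Measure α)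

/-- In a decreasing sequence, the indices of the sets containing a point form an initial segment.
Two initial segments are nested, so all the differences have the same sign and nothing cancels. -/
theorem sum_abs_indicator_sub_indicator {A : ℕ → Set α} (hA : Antitone A) (N : ℕ) (p q : α) :
    ∑ k ∈ Finset.range N, |(A k).indicator (fun _ => (1 : ℝ)) p - (A k).indicator (fun _ => 1) q| =
      |∑ k ∈ Finset.range N,
        ((A k).indicator (fun _ => (1 : ℝ)) p - (A k).indicator (fun _ => 1) q)| := by
  have aux (p q : α) (h : ∀ k, q ∈ A k → p ∈ A k) (k : ℕ) :
      0 ≤ (A k).indicator (fun _ => (1 : ℝ)) p - (A k).indicator (fun _ => 1) q := by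
    by_cases hq : q ∈ A k
    · simp [hq, h k hq]
    · rw [indicator_of_notMem hq, sub_zero]
      exact indicator_nonneg (fun _ _ => zero_le_one) p
  by_cases h : ∀ k, q ∈ A k → p ∈ A k
  · rw [abs_of_nonneg (Finset.sum_nonneg fun k _ => aux p q h k)]
    exact Finset.sum_congr rfl fun k _ => abs_of_nonneg (aux p q h k)
  · push Not at h
    obtain ⟨j, hqj, hpj⟩ := h
    have h' (k : ℕ) (hp : p ∈ A k) : q ∈ A k := by
      rcases le_total k j with hkj | hjk
      · exact hA hkj hqj
      · exact absurd (hA hjk hp) hpj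
    have haux (k : ℕ) := aux q p h' k
    rw [abs_of_nonpos (Finset.sum_nonpos fun k _ => by linarith [haux k]),
      ← Finset.sum_neg_distrib]
    exact Finset.sum_congr rfl fun k _ => abs_of_nonpos (by linarith [haux k])

/-- The layers of a nonnegative number at height at most `n + 1`. -/
theorem sum_indicator_eq (g : α → ℝ) (n N : ℕ) (x : α) (hx : 0 ≤ g x) :
    ∑ k ∈ Finset.range N,
      {y | ((k : ℝ) + 1) / (n + 1) ≤ g y}.indicator (fun _ => (1 : ℝ)) x =
      (min N ⌊g x * (n + 1)⌋₊ : ℕ) := by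
  have hn : (0 : ℝ) < n + 1 := by positivity
  have h (k : ℕ) : {y | ((k : ℝ) + 1) / (n + 1) ≤ g y}.indicator (fun _ => (1 : ℝ)) x =
      if k < ⌊g x * (n + 1)⌋₊ then 1 else 0 := by
    rw [indicator_apply]
    refine if_congr ?_ rfl rfl
    rw [mem_ofPred_eq, div_le_iff₀ hn, ← Nat.succ_le_iff, Nat.le_floor_iff (by positivity)]
    push_cast
    rfl
  simp_rw [h]
  rw [Finset.sum_ite, Finset.sum_const_zero, add_zero, Finset.sum_const, nsmul_one]
  congr 1
  have : (Finset.range N).filter (· < ⌊g x * (n + 1)⌋₊) =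
      Finset.range (min N ⌊g x * (n + 1)⌋₊) := by
    ext k
    simp
  rw [this, Finset.card_range]

/-- Approximation of a nonnegative integrable function by normalized sums of indicator functions
of decreasing sets. -/
theorem exists_antitone_norm_sum_sub_lt {g : Lp ℝ 1 μ} (hg : 0 ≤ g) {η : ℝ} (hη : 0 < η) :
    ∃ (c : ℝ) (N : ℕ) (A : ℕ → Set α) (hA : ∀ k, MeasurableSet (A k)) (hμ : ∀ k, μ (A k) ≠ ∞),
      0 < c ∧ Antitone A ∧
      ‖c • ∑ k ∈ Finset.range N, indicatorConstLp 1 (hA k) (hμ k) (1 : ℝ) - g‖ < η := by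
  have hgi := L1.integrable_coeFn g
  have hgm : Measurable g := (Lp.stronglyMeasurable g).measurable
  -- The levels start at `1 / (n + 1)` rather than at 0, so that every layer has finite measure.
  let A (n k : ℕ) : Set α := {y | ((k : ℝ) + 1) / (n + 1) ≤ g y}
  have hA (n k : ℕ) : MeasurableSet (A n k) := measurableSet_le measurable_const hgm
  have hμ (n k : ℕ) : μ (A n k) ≠ ∞ := (hgi.measure_ge_lt_top (by positivity)).ne
  let S (n : ℕ) : Lp ℝ 1 μ := (1 / (n + 1 : ℝ)) •
    ∑ k ∈ Finset.range ((n + 1) * (n + 1)), indicatorConstLp 1 (hA n k) (hμ n k) (1 : ℝ)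
  -- This is `g` rounded down to a multiple of `1 / (n + 1)` and capped at `n + 1`, the height
  -- reached by `(n + 1)²` layers. The cap is inactive at `x` once `n ≥ g x`.
  let s (n : ℕ) (x : α) : ℝ :=
    (min ((n + 1) * (n + 1)) ⌊g x * (n + 1)⌋₊ : ℕ) / (n + 1)
  have hS (n : ℕ) : S n =ᵐ[μ] s n := by
    have hall : ∀ᵐ x ∂μ, ∀ k, indicatorConstLp 1 (hA n k) (hμ n k) (1 : ℝ) x =
        (A n k).indicator (fun _ => 1) x :=
      ae_all_iff.2 fun k => indicatorConstLp_coeFn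
    filter_upwards [(Lp.coeFn_nonneg g).2 hg, hall, Lp.coeFn_smul (1 / (n + 1 : ℝ))
      (∑ k ∈ Finset.range ((n + 1) * (n + 1)), indicatorConstLp 1 (hA n k) (hμ n k) (1 : ℝ)),
      Lp.coeFn_finsetSum (Finset.range ((n + 1) * (n + 1)))
        fun k => indicatorConstLp 1 (hA n k) (hμ n k) (1 : ℝ)] with x h1 h2 h3 h4
    rw [h3, Pi.smul_apply, h4, Finset.sum_apply, Finset.sum_congr rfl fun k _ => h2 k,
      sum_indicator_eq g n _ x h1, smul_eq_mul, one_div_mul_eq_div]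
  have hsm (n : ℕ) : AEStronglyMeasurable (s n) μ :=
    (Lp.aestronglyMeasurable (S n)).congr (hS n)
  have hlim : Filter.Tendsto (fun n => ‖S n - g‖) Filter.atTop (𝓝 0) := by
    have h0 (n : ℕ) : ‖S n - g‖ = ∫ x, ‖s n x - g x‖ ∂μ := by
      rw [L1.norm_eq_integral_norm]
      refine integral_congr_ae ?_
      filter_upwards [Lp.coeFn_sub (S n) g, hS n] with x h1 h2
      rw [h1, Pi.sub_apply, h2]
    simp_rw [h0]
    rw [← integral_zero α ℝ (μ := μ)]
    refine tendsto_integral_of_dominated_convergence (fun x => ‖g x‖)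
      (fun n => ((hsm n).sub hgm.aestronglyMeasurable).norm) hgi.norm (fun n => ?_) ?_
    · filter_upwards [(Lp.coeFn_nonneg g).2 hg] with x hx
      have hx : 0 ≤ g x := hx
      have hn : (0 : ℝ) < n + 1 := by positivity
      have h1 : s n x ≤ g x := by
        rw [div_le_iff₀ hn]
        refine le_trans ?_ (Nat.floor_le (mul_nonneg hx hn.le))
        exact_mod_cast min_le_right _ _
      have h2 : 0 ≤ s n x := by positivity
      rw [norm_norm, Real.norm_eq_abs, Real.norm_eq_abs, abs_of_nonneg hx, abs_le]
      constructor <;> linarith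
    · filter_upwards [(Lp.coeFn_nonneg g).2 hg] with x hx
      have hx : 0 ≤ g x := hx
      rw [← norm_zero (E := ℝ)]
      refine Filter.Tendsto.norm ?_
      rw [← sub_self (g x)]
      refine Filter.Tendsto.sub_const ?_ _
      have h1 := (tendsto_nat_floor_mul_div_atTop (R := ℝ) hx).comp
        ((tendsto_natCast_atTop_atTop (R := ℝ)).comp (Filter.tendsto_add_atTop_nat 1))
      refine h1.congr' ?_
      filter_upwards [Filter.eventually_ge_atTop ⌈g x⌉₊] with n hn
      have h2 : g x ≤ n := Nat.ceil_le.1 hn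
      have h3 : ⌊g x * (n + 1)⌋₊ ≤ (n + 1) * (n + 1) := by
        refine Nat.floor_le_of_le ?_
        push_cast
        gcongr
        linarith
      simp only [Function.comp_apply, s, min_eq_right h3]
      push_cast
      rfl
  obtain ⟨n, hn⟩ := (hlim.eventually_lt_const hη).exists
  refine ⟨_, _, A n, hA n, hμ n, by positivity, fun k l hkl x hx => ?_, hn⟩
  refine le_trans ?_ (show ((l : ℝ) + 1) / (n + 1) ≤ g x from hx)
  gcongr

end Layers

/-! ### Følner's condition -/

section Folner

variable {G : Type*} [Group G] [TopologicalSpace G] [IsTopologicalGroup G]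
  [LocallyCompactSpace G] [T2Space G] [SigmaCompactSpace G] [MeasurableSpace G] [BorelSpace G]
  (μ : Measure G) [μ.IsHaarMeasure] [μ.Regular]

theorem coeFn_translate_indicator {A : Set G} (hA : MeasurableSet A) (hμ : μ A ≠ ∞) (x : G) :
    translate μ x (indicatorConstLp 1 hA hμ (1 : ℝ)) =ᵐ[μ]
      fun y => A.indicator (fun _ => 1) (x⁻¹ * y) := by
  filter_upwards [coeFn_translate μ x (indicatorConstLp 1 hA hμ (1 : ℝ)),
    (measurePreserving_mul_left μ x⁻¹).quasiMeasurePreserving.ae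
      (indicatorConstLp_coeFn (p := 1) (hs := hA) (hμs := hμ) (c := (1 : ℝ)))] with y h1 h2
  rw [h1, h2]

theorem norm_translate_indicator_sub {A : Set G} (hA : MeasurableSet A) (hμ : μ A ≠ ∞) (x : G) :
    ‖translate μ x (indicatorConstLp 1 hA hμ (1 : ℝ)) - indicatorConstLp 1 hA hμ 1‖ =
      μ.real (A ∆ (x • A)) := by
  have hxA : MeasurableSet (x • A) := hA.const_smul x
  rw [L1.norm_eq_integral_norm, ← integral_indicator_one (hA.symmDiff hxA)]
  refine integral_congr_ae ?_
  filter_upwards [Lp.coeFn_sub (translate μ x (indicatorConstLp 1 hA hμ (1 : ℝ)))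
    (indicatorConstLp 1 hA hμ 1), coeFn_translate_indicator μ hA hμ x,
    indicatorConstLp_coeFn (p := 1) (hs := hA) (hμs := hμ) (c := (1 : ℝ))] with y h1 h2 h3
  rw [h1, Pi.sub_apply, h2, h3]
  have h4 : x⁻¹ * y ∈ A ↔ y ∈ x • A := by rw [mem_smul_set_iff_inv_smul_mem, smul_eq_mul]
  by_cases hy : y ∈ A <;> by_cases hy' : y ∈ x • A <;>
    simp [indicator, h4, hy, hy', mem_symmDiff]

theorem norm_indicator_sub_indicator {A B : Set G} (hA : MeasurableSet A) (hμA : μ A ≠ ∞)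
    (hB : MeasurableSet B) (hμB : μ B ≠ ∞) (hBA : B ⊆ A) :
    ‖indicatorConstLp 1 hA hμA (1 : ℝ) - indicatorConstLp 1 hB hμB 1‖ = μ.real (A \ B) := by
  rw [L1.norm_eq_integral_norm, ← integral_indicator_one (hA.diff hB)]
  refine integral_congr_ae ?_
  filter_upwards [Lp.coeFn_sub (indicatorConstLp 1 hA hμA (1 : ℝ)) (indicatorConstLp 1 hB hμB 1),
    indicatorConstLp_coeFn (p := 1) (hs := hB) (hμs := hμB) (c := (1 : ℝ)),
    indicatorConstLp_coeFn (p := 1) (hs := hA) (hμs := hμA) (c := (1 : ℝ))] with y h1 h2 h3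
  rw [h1, Pi.sub_apply, h2, h3]
  by_cases hy : y ∈ B
  · simp [hy, hBA hy]
  · by_cases hy' : y ∈ A <;> simp [hy, hy']

theorem continuous_measureReal_symmDiff_smul {A : Set G} (hA : MeasurableSet A) (hμ : μ A ≠ ∞) :
    Continuous fun x : G => μ.real (A ∆ (x • A)) := by
  simp_rw [← norm_translate_indicator_sub μ hA hμ]
  exact ((continuous_translate μ _).sub continuous_const).norm

/-- The layers of a function share out its variation under a translation. -/
theorem sum_measureReal_symmDiff_eq {A : ℕ → Set G} (hA : ∀ k, MeasurableSet (A k))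
    (hμ : ∀ k, μ (A k) ≠ ∞) (hanti : Antitone A) (N : ℕ) (x : G) :
    ∑ k ∈ Finset.range N, μ.real (A k ∆ (x • A k)) =
      ‖translate μ x (∑ k ∈ Finset.range N, indicatorConstLp 1 (hA k) (hμ k) (1 : ℝ)) -
        ∑ k ∈ Finset.range N, indicatorConstLp 1 (hA k) (hμ k) (1 : ℝ)‖ := by
  rw [_root_.map_sum, ← Finset.sum_sub_distrib, L1.norm_eq_integral_norm]
  simp_rw [← norm_translate_indicator_sub μ (hA _) (hμ _), L1.norm_eq_integral_norm]
  rw [← integral_finsetSum _ fun k _ => (L1.integrable_coeFn _).norm]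
  refine integral_congr_ae ?_
  have hall : ∀ᵐ y ∂μ, ∀ k, (translate μ x (indicatorConstLp 1 (hA k) (hμ k) (1 : ℝ)) -
      indicatorConstLp 1 (hA k) (hμ k) (1 : ℝ) : Lp ℝ 1 μ) y =
      (A k).indicator (fun _ => 1) (x⁻¹ * y) - (A k).indicator (fun _ => 1) y :=
    ae_all_iff.2 fun k => by
      filter_upwards [Lp.coeFn_sub (translate μ x (indicatorConstLp 1 (hA k) (hμ k) (1 : ℝ)))
        (indicatorConstLp 1 (hA k) (hμ k) 1), coeFn_translate_indicator μ (hA k) (hμ k) x,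
        indicatorConstLp_coeFn (p := 1) (hs := hA k) (hμs := hμ k) (c := (1 : ℝ))] with y h1 h2 h3
      rw [h1, Pi.sub_apply, h2, h3]
  filter_upwards [hall, Lp.coeFn_finsetSum (Finset.range N) fun k =>
    (translate μ x (indicatorConstLp 1 (hA k) (hμ k) (1 : ℝ)) -
      indicatorConstLp 1 (hA k) (hμ k) (1 : ℝ) : Lp ℝ 1 μ)] with y h1 h2
  rw [h2, Finset.sum_apply]
  simp_rw [h1, Real.norm_eq_abs]
  exact sum_abs_indicator_sub_indicator hanti N _ _

/-- Følner's condition in mean over a compact set of translations. -/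
theorem exists_setIntegral_symmDiff_lt (hamen : IsAmenable μ) {K : Set G} (hK : IsCompact K)
    {η : ℝ} (hη : 0 < η) : ∃ A : Set G, MeasurableSet A ∧ μ A ≠ ∞ ∧
      ∫ x in K, μ.real (A ∆ (x • A)) ∂μ < η * μ.real A := by
  set M := μ.real K
  have hM : 0 ≤ M := measureReal_nonneg
  -- After scaling by `c`, the layers have total variation at most `3θ` under each `x ∈ K`, and
  -- total measure at least `1 - θ ≥ 1/2`. With `3θM < η/2`, some layer must satisfy the inequality.
  obtain ⟨θ, hθ0, hθ1, hθ2⟩ : ∃ θ : ℝ, 0 < θ ∧ θ ≤ 1 / 2 ∧ 6 * θ * M < η := by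
    refine ⟨min (1 / 2) (η / (6 * (M + 1))), by positivity, min_le_left _ _, ?_⟩
    calc 6 * min (1 / 2) (η / (6 * (M + 1))) * M ≤ 6 * (η / (6 * (M + 1))) * M := by
          gcongr
          exact min_le_right _ _
      _ = η * (M / (M + 1)) := by field_simp
      _ < η * 1 := by
          gcongr
          rw [div_lt_one (by positivity)]
          linarith
      _ = η := mul_one η
  obtain ⟨g, hg, hgK⟩ := exists_norm_translate_sub_lt μ hamen hK hθ0
  obtain ⟨c, N, A, hA, hμ, hc, hanti, happ⟩ := exists_antitone_norm_sum_sub_lt μ hg.1 hθ0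
  set S : Lp ℝ 1 μ := ∑ k ∈ Finset.range N, indicatorConstLp 1 (hA k) (hμ k) (1 : ℝ)
  have h1 (x : G) (hx : x ∈ K) : c * ∑ k ∈ Finset.range N, μ.real (A k ∆ (x • A k)) ≤ 3 * θ := by
    rw [sum_measureReal_symmDiff_eq μ hA hμ hanti N x]
    calc c * ‖translate μ x S - S‖ = ‖translate μ x (c • S) - c • S‖ := by
          rw [map_smul, ← smul_sub, norm_smul, Real.norm_of_nonneg hc.le]
      _ = ‖translate μ x (c • S - g) + (translate μ x g - g) - (c • S - g)‖ := by
          rw [map_sub]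
          congr 1
          abel
      _ ≤ ‖translate μ x (c • S - g)‖ + ‖translate μ x g - g‖ + ‖c • S - g‖ :=
          (norm_sub_le _ _).trans (add_le_add_left (norm_add_le _ _) _)
      _ ≤ θ + θ + θ := by
          rw [LinearIsometry.norm_map]
          exact add_le_add (add_le_add happ.le (hgK x hx).le) happ.le
      _ = 3 * θ := by ring
  have h2 : 1 / 2 ≤ c * ∑ k ∈ Finset.range N, μ.real (A k) := by
    have h3 : ‖c • S‖ ≤ c * ∑ k ∈ Finset.range N, μ.real (A k) := by
      rw [norm_smul, Real.norm_of_nonneg hc.le]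
      gcongr
      refine (norm_sum_le _ _).trans (Finset.sum_le_sum fun k _ => ?_)
      rw [norm_indicatorConstLp one_ne_zero ENNReal.one_ne_top]
      simp
    have h4 : ‖g‖ - ‖c • S‖ ≤ ‖c • S - g‖ := by
      rw [norm_sub_rev]
      exact norm_sub_norm_le _ _
    rw [hg.2] at h4
    linarith
  have hcont (k : ℕ) := continuous_measureReal_symmDiff_smul μ (hA k) (hμ k)
  have hint (k : ℕ) : IntegrableOn (fun x : G => μ.real (A k ∆ (x • A k))) K μ :=
    (hcont k).continuousOn.integrableOn_compact hK
  have h5 : c * ∑ k ∈ Finset.range N, ∫ x in K, μ.real (A k ∆ (x • A k)) ∂μ ≤ 3 * θ * M := by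
    rw [← integral_finsetSum _ fun k _ => hint k, ← integral_const_mul]
    calc ∫ x in K, c * ∑ k ∈ Finset.range N, μ.real (A k ∆ (x • A k)) ∂μ
        ≤ ∫ x in K, 3 * θ ∂μ := by
          refine setIntegral_mono_on ?_ (integrableOn_const hK.measure_lt_top.ne)
            hK.measurableSet h1
          exact (integrable_finsetSum _ fun k _ => hint k).const_mul c
      _ = 3 * θ * M := by rw [setIntegral_const, smul_eq_mul, mul_comm]
  have h6 : ∑ k ∈ Finset.range N, ∫ x in K, μ.real (A k ∆ (x • A k)) ∂μ <
      ∑ k ∈ Finset.range N, η * μ.real (A k) := by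
    rw [← Finset.mul_sum, ← mul_lt_mul_iff_of_pos_left hc]
    calc _ ≤ 3 * θ * M := h5
      _ < η * (1 / 2) := by linarith
      _ ≤ η * (c * ∑ k ∈ Finset.range N, μ.real (A k)) := by gcongr
      _ = _ := by ring
  obtain ⟨k, -, hk⟩ := Finset.exists_lt_of_sum_lt h6
  exact ⟨A k, hA k, hμ k, hk⟩

theorem measure_pos_of_setIntegral_lt {A : Set G} {K : Set G} {η : ℝ} (hη : 0 < η)
    (h : ∫ x in K, μ.real (A ∆ (x • A)) ∂μ < η * μ.real A) : 0 < μ.real A := by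
  have h0 : 0 ≤ ∫ x in K, μ.real (A ∆ (x • A)) ∂μ := integral_nonneg fun _ => measureReal_nonneg
  exact (pos_iff_pos_of_mul_pos (h0.trans_lt h)).1 hη

/-- Følner's condition: an amenable group has compact sets of positive measure that are almost
invariant, uniformly on compact sets of translations. -/
theorem nonempty_invariantSets (hamen : IsAmenable μ) {K : Set G} (hK : IsCompact K)
    {ε : ℝ} (hε : 0 < ε) (hε1 : ε < 1) : (invariantSets μ K ε).Nonempty := by
  obtain ⟨V, hV, hV1⟩ := exists_compact_mem_nhds (1 : G)
  have hVpos : 0 < μ.real V :=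
    ENNReal.toReal_pos (measure_pos_of_mem_nhds μ hV1).ne' hV.measure_lt_top.ne
  -- Each `k ∈ K` is `(kv)v⁻¹` with `v` and `kv` in `K'`. The bad set `N ⊆ K'` has measure at most
  -- `|V|/3`, so `N` and `k⁻¹N` do not cover `V`, and some `v` makes both factors good.
  set K' := V ∪ K * V
  have hK' : IsCompact K' := hV.union (hK.mul hV)
  -- The variation of the final compact set is below `4θ|A|`: `2θ` from composing two translations
  -- and `2θ` from shrinking `A` to `B`. Since `|B| > (1 - θ)|A|`, what is needed is `4θ ≤ ε(1 -
  -- θ)`.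
  set θ := ε / 8 with hθ
  have hθ0 : 0 < θ := by positivity
  obtain ⟨A, hA, hμA, hint⟩ := exists_setIntegral_symmDiff_lt μ hamen hK'
    (η := θ * (μ.real V / 3)) (by positivity)
  have hApos := measure_pos_of_setIntegral_lt μ (by positivity) hint
  set φ : G → ℝ := fun x => μ.real (A ∆ (x • A)) with hφ
  have hφc : Continuous φ := continuous_measureReal_symmDiff_smul μ hA hμA
  set N := {x | θ * μ.real A ≤ φ x} ∩ K'
  have hN : μ.real N ≤ μ.real V / 3 := by
    have h1 := mul_meas_ge_le_integral_of_nonneg (μ := μ.restrict K') (f := φ)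
      (.of_forall fun x => measureReal_nonneg) (hφc.continuousOn.integrableOn_compact hK')
      (θ * μ.real A)
    rw [measureReal_restrict_apply (measurableSet_le measurable_const hφc.measurable)] at h1
    have h2 := h1.trans_lt hint
    have h3 : θ * μ.real A * μ.real N < θ * μ.real A * (μ.real V / 3) := by linarith
    exact (lt_of_mul_lt_mul_left h3 (by positivity)).le
  have hNfin : μ N ≠ ∞ := measure_ne_top_of_subset inter_subset_right hK'.measure_lt_top.ne
  set I : Lp ℝ 1 μ := indicatorConstLp 1 hA hμA (1 : ℝ)
  have hI (x : G) : ‖translate μ x I - I‖ = φ x := norm_translate_indicator_sub μ hA hμA x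
  have hφK (k : G) (hk : k ∈ K) : φ k < 2 * θ * μ.real A := by
    obtain ⟨v, hvV, hv1, hv2⟩ : ∃ v ∈ V, φ v < θ * μ.real A ∧ φ (k * v) < θ * μ.real A := by
      by_contra! hne
      have hsub : V ⊆ N ∪ k⁻¹ • N := by
        intro v hv
        by_cases h1 : φ v < θ * μ.real A
        · refine Or.inr (mem_smul_set_iff_inv_smul_mem.2 ?_)
          rw [inv_inv, smul_eq_mul]
          exact ⟨hne v hv h1, Or.inr (mul_mem_mul hk hv)⟩
        · exact Or.inl ⟨not_lt.1 h1, Or.inl hv⟩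
      have hkN : μ (k⁻¹ • N) = μ N := measure_smul μ k⁻¹ N
      have h1 := (measureReal_mono hsub (measure_union_ne_top hNfin (hkN.trans_ne hNfin))).trans
        (measureReal_union_le _ _)
      rw [measureReal_def (s := k⁻¹ • N), hkN, ← measureReal_def] at h1
      linarith
    rw [← hI] at hv1 hv2 ⊢
    calc ‖translate μ k I - I‖ = ‖(translate μ (k * v) I - I) -
          translate μ k (translate μ v I - I)‖ := by
          rw [map_sub, translate_mul]
          congr 1
          abel
      _ ≤ ‖translate μ (k * v) I - I‖ + ‖translate μ v I - I‖ := by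
          refine (norm_sub_le _ _).trans ?_
          rw [LinearIsometry.norm_map]
      _ < 2 * θ * μ.real A := by linarith
  obtain ⟨B, hBA, hB, hAB⟩ := hA.exists_isCompact_sdiff_lt hμA
    (ε := ENNReal.ofReal (θ * μ.real A)) (by simpa using by positivity)
  have hμB : μ B ≠ ∞ := hB.measure_lt_top.ne
  have hABr : μ.real (A \ B) < θ * μ.real A := by
    rw [measureReal_def]
    exact (ENNReal.toReal_lt_of_lt_ofReal hAB)
  have hBr : (1 - θ) * μ.real A < μ.real B := by
    have := measureReal_sdiff_add_inter (μ := μ) (s := A) (t := B) hB.measurableSet hμA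
    rw [inter_eq_self_of_subset_right hBA] at this
    linarith
  have hθ1 : 0 < 1 - θ := by linarith
  have hBpos : 0 < μ.real B := lt_trans (by positivity) hBr
  refine ⟨B, hB, ?_, fun x hx => ?_⟩
  · exact (ENNReal.toReal_pos_iff.1 hBpos).1
  rw [div_lt_iff₀ hBpos, ← norm_translate_indicator_sub μ hB.measurableSet hμB]
  set J : Lp ℝ 1 μ := indicatorConstLp 1 hB.measurableSet hμB (1 : ℝ)
  have hIJ : ‖I - J‖ = μ.real (A \ B) :=
    norm_indicator_sub_indicator μ hA hμA hB.measurableSet hμB hBA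
  calc ‖translate μ x J - J‖
      = ‖(translate μ x I - I) - translate μ x (I - J) + (I - J)‖ := by
        rw [map_sub]
        congr 1
        abel
    _ ≤ ‖translate μ x I - I‖ + ‖I - J‖ + ‖I - J‖ := by
        refine (norm_add_le _ _).trans (add_le_add_left ((norm_sub_le _ _).trans ?_) _)
        rw [LinearIsometry.norm_map]
    _ < 4 * θ * μ.real A := by
        rw [hI, hIJ]
        linarith [hφK x hx]
    _ ≤ ε * ((1 - θ) * μ.real A) := by
        rw [← mul_assoc]
        refine mul_le_mul_of_nonneg_right ?_ hApos.le
        nlinarith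
    _ ≤ ε * μ.real B := by gcongr

end Folner

/-! ### Averages over sets and weak-* limits -/

section Average

variable {α : Type*} [MeasurableSpace α] (μ : Measure α)

theorem norm_one_le : ‖one μ‖ ≤ 1 := by
  rw [one, Lp.norm_toLp, eLpNorm_exponent_top]
  exact ENNReal.toReal_le_of_le_ofReal zero_le_one
    (eLpNormEssSup_le_of_ae_bound (.of_forall fun x => by simp))

theorem norm_eq_one_of_one_le {m : StrongDual ℂ (Lp ℂ ∞ μ)} (hm : ‖m‖ ≤ 1)
    (h1 : 1 ≤ (m (one μ)).re) : ‖m‖ = 1 := by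
  refine le_antisymm hm ?_
  calc (1 : ℝ) ≤ ‖m (one μ)‖ := h1.trans (Complex.re_le_norm _)
    _ ≤ ‖m‖ * ‖one μ‖ := m.le_opNorm _
    _ ≤ ‖m‖ := mul_le_of_le_one_right (norm_nonneg m) (norm_one_le μ)

theorem integrableOn_coeFn {A : Set α} (hA : μ A ≠ ∞) (φ : Lp ℂ ∞ μ) : IntegrableOn φ A μ :=
  Measure.integrableOn_of_bounded hA (Lp.aestronglyMeasurable φ)
    (ae_restrict_of_ae (ae_norm_le μ φ))

/-- The mean `φ ↦ |A|⁻¹ ∫_A φ`. -/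
noncomputable def average (A : Set α) (hA : μ A ≠ ∞) : StrongDual ℂ (Lp ℂ ∞ μ) :=
  LinearMap.mkContinuous
    { toFun φ := ((μ.real A)⁻¹ : ℂ) * ∫ x in A, φ x ∂μ
      map_add' φ ψ := by
        rw [← mul_add, ← integral_add (integrableOn_coeFn μ hA φ) (integrableOn_coeFn μ hA ψ)]
        congr 1
        exact integral_congr_ae (ae_restrict_of_ae (Lp.coeFn_add φ ψ))
      map_smul' c φ := by
        rw [RingHom.id_apply, smul_eq_mul, mul_left_comm]
        congr 1
        rw [← integral_const_mul]
        exact integral_congr_ae (ae_restrict_of_ae (Lp.coeFn_smul c φ)) } 1 fun φ => by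
    change ‖((μ.real A)⁻¹ : ℂ) * ∫ x in A, φ x ∂μ‖ ≤ 1 * ‖φ‖
    have h := norm_setIntegral_le_of_norm_le_const_ae' (C := ‖φ‖) hA.lt_top
      ((ae_norm_le μ φ).mono fun x hx _ => hx)
    rw [norm_mul, norm_inv, Complex.norm_real, Real.norm_of_nonneg measureReal_nonneg, one_mul,
      inv_mul_eq_div]
    exact div_le_of_le_mul₀ measureReal_nonneg (norm_nonneg _) h

theorem average_apply {A : Set α} (hA : μ A ≠ ∞) (φ : Lp ℂ ∞ μ) :
    average μ A hA φ = ((μ.real A)⁻¹ : ℂ) * ∫ x in A, φ x ∂μ := rfl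

theorem norm_average_le {A : Set α} (hA : μ A ≠ ∞) : ‖average μ A hA‖ ≤ 1 :=
  LinearMap.mkContinuous_norm_le _ zero_le_one _

theorem average_nonneg {A : Set α} (hA : μ A ≠ ∞) {φ : Lp ℂ ∞ μ} (hφ : ∀ᵐ x ∂μ, 0 ≤ φ x) :
    0 ≤ average μ A hA φ := by
  rw [average_apply]
  refine mul_nonneg ?_ (integral_nonneg_of_ae (ae_restrict_of_ae hφ))
  rw [← Complex.ofReal_inv]
  exact_mod_cast inv_nonneg.2 measureReal_nonneg

theorem average_ind {A E : Set α} (hA : μ A ≠ ∞) (hE : MeasurableSet E) :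
    average μ A hA (ind μ E hE) = ((μ.real (A ∩ E) / μ.real A : ℝ) : ℂ) := by
  have h : ∫ x in A, ind μ E hE x ∂μ = μ.real (A ∩ E) := by
    rw [integral_congr_ae (ae_restrict_of_ae (coeFn_ind hE)), setIntegral_indicator hE,
      setIntegral_const]
    simp
  rw [average_apply, h]
  push_cast
  rw [inv_mul_eq_div]

theorem ind_univ : ind μ univ MeasurableSet.univ = one μ := by
  refine Lp.ext ?_
  filter_upwards [coeFn_ind (μ := μ) MeasurableSet.univ, coeFn_one (μ := μ)] with x h1 h2
  rw [h1, h2, indicator_univ]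

/-- Weak-* compactness, for sequences and a free ultrafilter. -/
theorem exists_tendsto_hyperfilter {E : Type*} [NormedAddCommGroup E] [NormedSpace ℂ E]
    {m : ℕ → StrongDual ℂ E} (hm : ∀ n, ‖m n‖ ≤ 1) :
    ∃ l : StrongDual ℂ E, ‖l‖ ≤ 1 ∧
      ∀ φ, Filter.Tendsto (fun n => m n φ) (Filter.hyperfilter ℕ) (𝓝 (l φ)) := by
  have hc := WeakDual.isCompact_closedBall (0 : StrongDual ℂ E) 1
  obtain ⟨l, hl, hlim⟩ := hc.ultrafilter_le_nhds
    ((Filter.hyperfilter ℕ).map fun n => StrongDual.toWeakDual (m n)) (by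
      rw [Filter.le_principal_iff]
      refine Filter.mem_map.2 (Filter.univ_mem' fun n => ?_)
      simpa using hm n)
  refine ⟨WeakDual.toStrongDual l, by simpa using hl, fun φ => ?_⟩
  exact ((WeakDual.eval_continuous φ).tendsto l).comp hlim

end Average

/-! ### Limits of Følner sequences -/

section Limits

variable {G : Type*} [Group G] [TopologicalSpace G] [IsTopologicalGroup G]
  [LocallyCompactSpace G] [T2Space G] [SigmaCompactSpace G] [MeasurableSpace G] [BorelSpace G]
  (μ : Measure G) [μ.IsHaarMeasure] [μ.Regular]

/-- Translating `φ` by `x` amounts to translating the domain by `x⁻¹`, and the difference of the two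
integrals is supported on the symmetric difference. -/
theorem norm_setIntegral_translate_sub_le {A : Set G} (hA : MeasurableSet A) (hμ : μ A ≠ ∞)
    (φ : Lp ℂ ∞ μ) (x : G) :
    ‖∫ y in A, φ (x⁻¹ * y) ∂μ - ∫ y in A, φ y ∂μ‖ ≤ ‖φ‖ * μ.real (A ∆ (x⁻¹ • A)) := by
  set I : Lp ℝ 1 μ := indicatorConstLp 1 hA hμ (1 : ℝ)
  have hi (h : Lp ℝ 1 μ) : Integrable (fun x => h x • φ x) μ := by
    simpa using integrable_smul_comp_mul_left μ h φ 1
  have h1 : ∫ y in A, φ (x⁻¹ * y) ∂μ = ∫ y, translate μ x⁻¹ I y • φ y ∂μ := by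
    rw [← integral_indicator hA,
      ← integral_mul_left_eq_self (fun y => translate μ x⁻¹ I y • φ y) x⁻¹]
    refine integral_congr_ae ?_
    filter_upwards [(measurePreserving_mul_left μ x⁻¹).quasiMeasurePreserving.ae
      (coeFn_translate_indicator μ hA hμ x⁻¹)] with y hy
    rw [hy, inv_inv, mul_inv_cancel_left]
    by_cases hyA : y ∈ A <;> simp [hyA]
  have h2 : ∫ y in A, φ y ∂μ = ∫ y, I y • φ y ∂μ := by
    rw [← integral_indicator hA]
    refine integral_congr_ae ?_
    filter_upwards [indicatorConstLp_coeFn (p := 1) (hs := hA) (hμs := hμ) (c := (1 : ℝ))]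
      with y hy
    rw [hy]
    by_cases hyA : y ∈ A <;> simp [hyA]
  rw [h1, h2, ← integral_sub (hi _) (hi _), ← norm_translate_indicator_sub μ hA hμ]
  refine le_trans (le_of_eq ?_) (norm_integral_smul_le μ _ (ae_norm_le μ φ))
  congr 1
  refine integral_congr_ae ?_
  filter_upwards [Lp.coeFn_sub (translate μ x⁻¹ I) I] with y hy
  rw [hy, Pi.sub_apply, sub_smul]

theorem setIntegral_conv {A : Set G} (hA : MeasurableSet A) (hμ : μ A ≠ ∞) (f : Lp ℝ 1 μ)
    (φ : Lp ℂ ∞ μ) :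
    ∫ y in A, conv μ f φ y ∂μ = ∫ x, f x • ∫ y in A, φ (x⁻¹ * y) ∂μ ∂μ := by
  set I : Lp ℝ 1 μ := indicatorConstLp 1 hA hμ (1 : ℝ)
  have h (ψ : G → ℂ) : ∫ y in A, ψ y ∂μ = ∫ y, I y • ψ y ∂μ := by
    rw [← integral_indicator hA]
    refine integral_congr_ae ?_
    filter_upwards [indicatorConstLp_coeFn (p := 1) (hs := hA) (hμs := hμ) (c := (1 : ℝ))]
      with y hy
    rw [hy]
    by_cases hyA : y ∈ A <;> simp [hyA]
  rw [integral_congr_ae (ae_restrict_of_ae (coeFn_conv μ f φ)), h]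
  simp_rw [h]
  exact integral_smul_convFun μ f I φ

theorem continuous_setIntegral_translate {A : Set G} (hA : MeasurableSet A) (hμ : μ A ≠ ∞)
    (φ : Lp ℂ ∞ μ) : Continuous fun x : G => ∫ y in A, φ (x⁻¹ * y) ∂μ := by
  refine (continuous_integral_smul_comp μ (indicatorConstLp 1 hA hμ (1 : ℝ)) φ).congr fun x => ?_
  rw [← integral_indicator hA]
  refine integral_congr_ae ?_
  filter_upwards [indicatorConstLp_coeFn (p := 1) (hs := hA) (hμs := hμ) (c := (1 : ℝ))] with y hy
  rw [hy]
  by_cases hyA : y ∈ A <;> simp [hyA]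

/-- Averages over asymptotically invariant sets are asymptotically topologically invariant. -/
theorem tendsto_average_conv_sub {A : ℕ → Set G} (hA : ∀ n, IsCompact (A n))
    (hpos : ∀ n, 0 < μ (A n)) {E : CompactExhaustion G} {ε : ℕ → ℝ}
    (hε : Filter.Tendsto ε Filter.atTop (𝓝 0))
    (hinv : ∀ n, ∀ x ∈ E n, μ.real (A n ∆ (x • A n)) / μ.real (A n) < ε n)
    {f : Lp ℝ 1 μ} (hf : f ∈ P₁ μ) (φ : Lp ℂ ∞ μ) :
    Filter.Tendsto (fun n => average μ (A n) (hA n).measure_lt_top.ne (conv μ f φ) -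
      average μ (A n) (hA n).measure_lt_top.ne φ) Filter.atTop (𝓝 0) := by
  have hμ (n : ℕ) : μ (A n) ≠ ∞ := (hA n).measure_lt_top.ne
  have hposr (n : ℕ) : 0 < μ.real (A n) := ENNReal.toReal_pos (hpos n).ne' (hμ n)
  -- `d n x` is the average of `l_x φ - φ` over `A n`. The difference in question is the integral of
  -- `d n` against `f`; `d n x → 0` for each `x`, with the uniform bound `2‖φ‖`.
  let d (n : ℕ) (x : G) : ℂ :=
    ((μ.real (A n))⁻¹ : ℂ) * (∫ y in A n, φ (x⁻¹ * y) ∂μ - ∫ y in A n, φ y ∂μ)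
  have hd (n : ℕ) (x : G) : ‖d n x‖ ≤
      ‖φ‖ * (μ.real (A n ∆ (x⁻¹ • A n)) / μ.real (A n)) := by
    rw [norm_mul, norm_inv, Complex.norm_real, Real.norm_of_nonneg (hposr n).le, inv_mul_eq_div,
      mul_div_assoc']
    gcongr
    exact norm_setIntegral_translate_sub_le μ (hA n).measurableSet (hμ n) φ x
  have hd2 (n : ℕ) (x : G) : ‖d n x‖ ≤ ‖φ‖ * 2 := by
    refine (hd n x).trans ?_
    gcongr
    rw [div_le_iff₀ (hposr n), two_mul]
    have h1 : μ.real (x⁻¹ • A n) = μ.real (A n) := by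
      rw [measureReal_def, measure_smul, measureReal_def]
    refine (measureReal_mono symmDiff_subset_union ?_).trans
      ((measureReal_union_le _ _).trans (by rw [h1]))
    exact measure_union_ne_top (hμ n) (by rw [measure_smul]; exact hμ n)
  have hdc (n : ℕ) : Continuous (d n) :=
    continuous_const.mul ((continuous_setIntegral_translate μ (hA n).measurableSet (hμ n) φ).sub
      continuous_const)
  have hdlim (x : G) : Filter.Tendsto (fun n => d n x) Filter.atTop (𝓝 0) := by
    have h1 : Filter.Tendsto (fun n => ‖φ‖ * ε n) Filter.atTop (𝓝 0) := by
      simpa using hε.const_mul ‖φ‖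
    refine squeeze_zero_norm' ?_ h1
    obtain ⟨N, hN⟩ := E.exists_mem x⁻¹
    filter_upwards [Filter.eventually_ge_atTop N] with n hn
    refine (hd n x).trans ?_
    gcongr
    exact (hinv n x⁻¹ (E.subset hn hN)).le
  have hkey (n : ℕ) : average μ (A n) (hμ n) (conv μ f φ) - average μ (A n) (hμ n) φ =
      ∫ x, f x • d n x ∂μ := by
    have h1 : ∫ y in A n, φ y ∂μ = ∫ x, f x • ∫ y in A n, φ y ∂μ ∂μ := by
      rw [integral_smul_const, ((mem_P₁_iff μ).1 hf).2, one_smul]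
    have hi1 : Integrable (fun x => f x • ∫ y in A n, φ (x⁻¹ * y) ∂μ) μ := by
      have h2 := (L1.integrable_coeFn f).smul_bdd (‖φ‖ * μ.real (A n))
        (continuous_setIntegral_translate μ (hA n).measurableSet (hμ n)
          φ).measurable.aestronglyMeasurable (.of_forall fun x => ?_)
      · exact h2
      · exact norm_setIntegral_le_of_norm_le_const_ae' (hμ n).lt_top
          (((measurePreserving_mul_left μ x⁻¹).quasiMeasurePreserving.ae (ae_norm_le μ φ)).mono
            fun y hy _ => hy)
    have hi2 : Integrable (fun x => f x • ∫ y in A n, φ y ∂μ) μ :=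
      (L1.integrable_coeFn f).smul_const _
    rw [average_apply, average_apply, setIntegral_conv μ (hA n).measurableSet (hμ n), ← mul_sub]
    conv_lhs => rw [h1]
    rw [← integral_sub hi1 hi2, ← integral_const_mul]
    congr 1 with x
    rw [← smul_sub, mul_smul_comm]
  simp_rw [hkey]
  rw [← integral_zero G ℂ (μ := μ)]
  refine tendsto_integral_of_dominated_convergence (fun x => ‖f x‖ * (‖φ‖ * 2))
    (fun n => (Lp.aestronglyMeasurable f).smul (hdc n).measurable.aestronglyMeasurable)
    ((L1.integrable_coeFn f).norm.mul_const _) (fun n => .of_forall fun x => ?_)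
    (.of_forall fun x => ?_)
  · rw [norm_smul]
    gcongr
    exact hd2 n x
  · simpa using (hdlim x).const_smul (f x)

/-- A sequence of asymptotically invariant compact sets has a limit point in `TLIM₀`. -/
theorem exists_mem_TLIM₀ {A : ℕ → Set G} {E : CompactExhaustion G} {ε : ℕ → ℝ}
    (hε : Filter.Tendsto ε Filter.atTop (𝓝 0)) (hA : ∀ n, A n ∈ invariantSets μ (E n) (ε n)) :
    ∃ m ∈ TLIM₀ μ, ∀ (S : Set G) (hS : MeasurableSet S), (∀ n, A n ⊆ S) → m (ind μ S hS) = 1 := by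
  have hμ (n : ℕ) : μ (A n) ≠ ∞ := (hA n).1.measure_lt_top.ne
  have hpos (n : ℕ) : 0 < μ.real (A n) := ENNReal.toReal_pos (hA n).2.1.ne' (hμ n)
  obtain ⟨m, hm1, hlim⟩ := exists_tendsto_hyperfilter fun n => norm_average_le μ (hμ n)
  have hone (S : Set G) (hS : MeasurableSet S) (h : ∀ n, A n ⊆ S) : m (ind μ S hS) = 1 := by
    refine tendsto_nhds_unique (hlim _) (tendsto_const_nhds.congr fun n => ?_)
    rw [average_ind, inter_eq_self_of_subset_left (h n), div_self (hpos n).ne', Complex.ofReal_one]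
  have hmean : m ∈ Means μ := by
    refine ⟨norm_eq_one_of_one_le μ hm1 ?_, fun φ hφ => ?_⟩
    · rw [← ind_univ, hone _ _ fun n => subset_univ _, Complex.one_re]
    · exact ge_of_tendsto' (hlim φ) fun n => average_nonneg μ (hμ n) hφ
  refine ⟨m, ⟨⟨hmean, fun f hf φ => ?_⟩, fun P hP K δ hK hδ hδ1 => ?_⟩, hone⟩
  · have h1 := (tendsto_average_conv_sub μ (fun n => (hA n).1) (fun n => (hA n).2.1) hε
      (fun n => (hA n).2.2) hf φ).mono_left Nat.hyperfilter_le_atTop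
    have h2 := tendsto_nhds_unique h1 ((hlim (conv μ f φ)).sub (hlim φ))
    exact (sub_eq_zero.1 h2.symm).symm
  · obtain ⟨N, hN⟩ := E.exists_superset_of_isCompact hK
    -- A free ultrafilter is finer than `atTop`, so invariance under `K` and approximation on the
    -- finitely many parts hold for a common `n`.
    have h1 : ∀ᶠ n in (Filter.hyperfilter ℕ : Filter ℕ), N ≤ n ∧ ε n < δ :=
      Nat.hyperfilter_le_atTop
        ((Filter.eventually_ge_atTop N).and (hε.eventually_lt_const hδ))
    have h2 : ∀ᶠ n in (Filter.hyperfilter ℕ : Filter ℕ), ∀ S : P.parts,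
        ‖m (ind μ S (hP S S.2)) - average μ (A n) (hμ n) (ind μ S (hP S S.2))‖ < δ := by
      rw [Filter.eventually_all]
      intro S
      have h3 := (tendsto_const_nhds (x := m (ind μ S (hP S S.2)))).sub
        (hlim (ind μ S (hP S S.2)))
      rw [sub_self] at h3
      simpa using h3.norm.eventually_lt_const (by simpa using hδ)
    obtain ⟨n, ⟨hn1, hn2⟩, hn3⟩ := (h1.and h2).exists
    refine ⟨A n, ⟨(hA n).1, (hA n).2.1, fun x hx => ?_⟩, fun S hS => ?_⟩
    · exact ((hA n).2.2 x (E.subset hn1 (hN hx))).trans hn2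
    · rw [← average_ind μ (hμ n)]
      exact hn3 ⟨S, hS⟩

/-- Right and left translations commute, and `Δ(t)` cancels from the ratio. -/
theorem image_mul_right_mem_invariantSets {A K : Set G} {ε : ℝ} (hA : A ∈ invariantSets μ K ε)
    (t : G) : (fun y => y * t) '' A ∈ invariantSets μ K ε := by
  have hreal (S : Set G) : μ.real ((fun y => y * t) '' S) = modular t * μ.real S := by
    rw [measureReal_def, measure_mul_right_eq, ENNReal.toReal_mul, ENNReal.coe_toReal,
      measureReal_def]
  have ht : (modular t : ℝ) ≠ 0 := by exact_mod_cast (modular_pos t).ne'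
  refine ⟨hA.1.image (continuous_mul_const t), ?_, fun x hx => ?_⟩
  · rw [measure_mul_right_eq]
    exact ENNReal.mul_pos (by exact_mod_cast (modular_pos t).ne') hA.2.1.ne'
  · have h1 : x • ((fun y => y * t) '' A) = (fun y => y * t) '' (x • A) := by
      rw [← image_smul, ← image_smul, image_image, image_image]
      simp [mul_assoc]
    rw [h1, ← image_symmDiff (mul_left_injective t), hreal, hreal, mul_div_mul_left _ _ ht]
    exact hA.2.2 x hx

theorem exists_modular_lt {G : Type*} [Group G] [TopologicalSpace G] [IsTopologicalGroup G]
    [LocallyCompactSpace G] (h : ¬ IsUnimodular G) {c : ℝ≥0} (hc : 0 < c) :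
    ∃ t : G, modular t < c := by
  have hone : (modular (1 : G)) = 1 := by simp [modular]
  have hpow (x : G) (n : ℕ) : modular (x ^ n) = modular x ^ n := by
    induction n with
    | zero => simpa using hone
    | succ n ih => rw [pow_succ, modular_mul, ih, pow_succ]
  obtain ⟨x, hx⟩ : ∃ x : G, modular x < 1 := by
    simp only [IsUnimodular, not_forall] at h
    obtain ⟨x, hx⟩ := h
    rcases lt_or_gt_of_ne hx with h1 | h1
    · exact ⟨x, h1⟩
    · refine ⟨x⁻¹, ?_⟩
      have h2 : modular x⁻¹ * modular x = 1 := by rw [← modular_mul, inv_mul_cancel, hone]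
      by_contra! h3
      exact absurd h2 (one_lt_mul_of_le_of_lt h3 h1).ne'
  obtain ⟨n, hn⟩ := exists_pow_lt_of_lt_one hc hx
  exact ⟨x ^ n, by rwa [hpow]⟩

theorem exists_lt_modular {G : Type*} [Group G] [TopologicalSpace G] [IsTopologicalGroup G]
    [LocallyCompactSpace G] (h : ¬ IsUnimodular G) (c : ℝ≥0) :
    ∃ t : G, c < modular t := by
  obtain ⟨t, ht⟩ := exists_modular_lt h (c := (c + 1)⁻¹) (by positivity)
  refine ⟨t⁻¹, ?_⟩
  have h2 : modular t⁻¹ = (modular t)⁻¹ := by simp [modular, modularCharacter_inv]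
  rw [h2]
  have h3 := (lt_inv_comm₀ (modular_pos t) (by positivity)).1 ht
  exact (lt_add_one c).trans h3

/-- Limit points of Følner sequences concentrated where the modular function is large,
respectively small. -/
theorem exists_TLIM₀_concentrated (hamen : IsAmenable μ) (hmod : ¬ IsUnimodular G) {δ : ℝ}
    (hδ : 0 < δ) :
    ∃ m₁ ∈ TLIM₀ μ, ∃ m₂ ∈ TLIM₀ μ,
      ∃ (X Y : Set G) (hX : MeasurableSet X) (hY : MeasurableSet Y),
        X ⊆ {x | 1 ≤ modular x} ∧ Y ⊆ {x | (modular x : ℝ) ≤ δ} ∧ μ Y ≤ 1 ∧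
        m₁ (ind μ X hX) = 1 ∧ m₂ (ind μ Y hY) = 1 := by
  let E : CompactExhaustion G := default
  -- The shift to `1 / (n + 2)` keeps `ε 0 < 1`, as Følner's condition is stated for `ε < 1`.
  let ε : ℕ → ℝ := fun n => 1 / ((n + 1 : ℕ) + 1)
  have hε : Filter.Tendsto ε Filter.atTop (𝓝 0) :=
    (tendsto_one_div_add_atTop_nhds_zero_nat (𝕜 := ℝ)).comp (Filter.tendsto_add_atTop_nat 1)
  have hε0 (n : ℕ) : 0 < ε n := by positivity
  have hε1 (n : ℕ) : ε n < 1 := by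
    rw [div_lt_one (by positivity)]
    push_cast
    linarith [(Nat.cast_nonneg n : (0 : ℝ) ≤ n)]
  choose A hA using fun n => nonempty_invariantSets μ hamen (E.isCompact n) (hε0 n) (hε1 n)
  have hne (n : ℕ) : (A n).Nonempty := nonempty_of_measure_ne_zero (hA n).2.1.ne'
  -- `Δ` has a positive minimum on the compact set `A n`, and translating by `t` with `Δ(t)` above
  -- its inverse pushes the whole set into `{Δ ≥ 1}`.
  have hX (n : ℕ) : ∃ t, ∀ x ∈ (fun y => y * t) '' A n, 1 ≤ modular x := by
    obtain ⟨a, -, ha⟩ := (hA n).1.exists_isMinOn (hne n) continuous_modular.continuousOn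
    obtain ⟨t, ht⟩ := exists_lt_modular hmod (modular a)⁻¹
    refine ⟨t, ?_⟩
    rintro _ ⟨x, hx, rfl⟩
    have h1 : modular a ≤ modular x := ha hx
    calc 1 = modular a * (modular a)⁻¹ := (mul_inv_cancel₀ (modular_pos a).ne').symm
      _ ≤ modular x * modular t := mul_le_mul' h1 ht.le
      _ = modular (x * t) := (modular_mul x t).symm
  have hY (n : ℕ) : ∃ t, (∀ x ∈ (fun y => y * t) '' A n, (modular x : ℝ) ≤ δ) ∧
      μ ((fun y => y * t) '' A n) ≤ 2⁻¹ ^ (n + 1) := by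
    obtain ⟨a, -, ha⟩ := (hA n).1.exists_isMaxOn (hne n) continuous_modular.continuousOn
    have hM : μ (A n) = ((μ (A n)).toNNReal : ℝ≥0∞) :=
      (ENNReal.coe_toNNReal (hA n).1.measure_lt_top.ne).symm
    set M := (μ (A n)).toNNReal
    have hMpos : 0 < M := by
      have := (hA n).2.1
      rw [hM] at this
      exact_mod_cast this
    -- The first bound on `Δ(t)` brings the maximum of `Δ` below `δ`. The second makes the measure
    -- at most `2⁻¹ ^ (n + 1)`, so that the union over `n` has measure at most 1.
    obtain ⟨t, ht⟩ := exists_modular_lt hmod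
      (c := min (δ.toNNReal / modular a) (2⁻¹ ^ (n + 1) / M))
      (lt_min (div_pos (Real.toNNReal_pos.2 hδ) (modular_pos a)) (by positivity))
    refine ⟨t, ?_, ?_⟩
    · rintro _ ⟨x, hx, rfl⟩
      have h1 : modular x ≤ modular a := ha hx
      have h2 : modular (x * t) ≤ δ.toNNReal := by
        calc modular (x * t) = modular x * modular t := modular_mul x t
          _ ≤ modular a * (δ.toNNReal / modular a) :=
              mul_le_mul' h1 (ht.le.trans (min_le_left _ _))
          _ = δ.toNNReal := mul_div_cancel₀ _ (modular_pos a).ne'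
      calc (modular (x * t) : ℝ) ≤ δ.toNNReal := by exact_mod_cast h2
        _ = δ := Real.coe_toNNReal δ hδ.le
    · rw [measure_mul_right_eq, hM]
      have h2 : modular t * M ≤ 2⁻¹ ^ (n + 1) :=
        (le_div_iff₀ hMpos).1 (ht.le.trans (min_le_right _ _))
      have h3 : ((modular t * M : ℝ≥0) : ℝ≥0∞) ≤ ((2⁻¹ ^ (n + 1) : ℝ≥0) : ℝ≥0∞) := by
        exact_mod_cast h2
      refine le_trans (by rw [ENNReal.coe_mul]) (h3.trans (le_of_eq ?_))
      rw [ENNReal.coe_pow, ENNReal.coe_inv two_ne_zero]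
      rfl
  choose t ht using hX
  choose s hs hs' using hY
  obtain ⟨m₁, hm₁, h₁⟩ := exists_mem_TLIM₀ μ hε
    fun n => image_mul_right_mem_invariantSets μ (hA n) (t n)
  obtain ⟨m₂, hm₂, h₂⟩ := exists_mem_TLIM₀ μ hε
    fun n => image_mul_right_mem_invariantSets μ (hA n) (s n)
  have hXm : MeasurableSet {x : G | 1 ≤ modular x} :=
    (isClosed_le continuous_const continuous_modular).measurableSet
  have hYm : MeasurableSet (⋃ n, (fun y => y * s n) '' A n) :=
    .iUnion fun n => ((hA n).1.image (continuous_mul_const (s n))).measurableSet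
  refine ⟨m₁, hm₁, m₂, hm₂, _, _, hXm, hYm, Subset.rfl, iUnion_subset fun n x hx => hs n x hx, ?_,
    h₁ _ hXm fun n x hx => ht n x hx, h₂ _ hYm fun n => subset_iUnion_of_subset n Subset.rfl⟩
  calc μ (⋃ n, (fun y => y * s n) '' A n) ≤ ∑' n, μ ((fun y => y * s n) '' A n) :=
        measure_iUnion_le _
    _ ≤ ∑' n, 2⁻¹ ^ (n + 1) := ENNReal.tsum_le_tsum hs'
    _ = 1 := by
        rw [ENNReal.tsum_geometric_add_one, ENNReal.one_sub_inv_two, inv_inv]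
        exact ENNReal.inv_mul_cancel two_ne_zero ENNReal.ofNat_ne_top

end Limits

/-! ### The midpoint is not a limit point -/

section Midpoint

variable {G : Type*} [Group G] [TopologicalSpace G] [IsTopologicalGroup G]
  [LocallyCompactSpace G] [T2Space G] [SigmaCompactSpace G] [MeasurableSpace G] [BorelSpace G]
  (μ : Measure G) [μ.IsHaarMeasure] [μ.Regular]

theorem ind_inter_add_ind_diff {α : Type*} [MeasurableSpace α] (μ : Measure α) {X Y : Set α}
    (hX : MeasurableSet X) (hY : MeasurableSet Y) :
    ind μ (X ∩ Y) (hX.inter hY) + ind μ (X \ Y) (hX.diff hY) = ind μ X hX := by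
  refine Lp.ext ?_
  filter_upwards [Lp.coeFn_add (ind μ (X ∩ Y) (hX.inter hY)) (ind μ (X \ Y) (hX.diff hY)),
    coeFn_ind (μ := μ) (hX.inter hY), coeFn_ind (μ := μ) (hX.diff hY),
    coeFn_ind (μ := μ) hX] with x h1 h2 h3 h4
  rw [h1, Pi.add_apply, h2, h3, h4]
  by_cases hx : x ∈ X <;> by_cases hy : x ∈ Y <;> simp [hx, hy]

theorem ind_empty {α : Type*} [MeasurableSpace α] (μ : Measure α) {X : Set α}
    (hX : MeasurableSet X) (h : X = ∅) : ind μ X hX = 0 := by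
  subst h
  refine Lp.ext ?_
  filter_upwards [coeFn_ind (μ := μ) hX, Lp.coeFn_zero ℂ ∞ μ] with x h1 h2
  rw [h1, h2]
  simp

/-- The partition of a space generated by two sets. -/
theorem exists_finpartition {α : Type*} [MeasurableSpace α] {X Y : Set α}
    (hX : MeasurableSet X) (hY : MeasurableSet Y) :
    ∃ P : Finpartition (univ : Set α), (∀ E ∈ P.parts, MeasurableSet E) ∧
      ∀ E, E = X ∩ Y ∨ E = X \ Y ∨ E = Y \ X → E = ∅ ∨ E ∈ P.parts := by
  classical
  -- The parts of a `Finpartition` are nonempty, so empty cells are erased; hence the alternative `E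
  -- = ∅` in the statement.
  let F : Finset (Set α) := {X ∩ Y, X \ Y, Y \ X, (X ∪ Y)ᶜ}
  have hdisj : F.SupIndep id := by
    rw [Finset.supIndep_iff_pairwiseDisjoint]
    intro A hA B hB hAB
    simp only [F, Finset.coe_insert, Finset.coe_singleton, mem_insert_iff, mem_singleton_iff]
      at hA hB
    have key (hne : A ≠ B) : ∀ x, x ∈ A → x ∉ B := by
      intro x hxA hxB
      apply hne
      rcases hA with rfl | rfl | rfl | rfl <;> rcases hB with rfl | rfl | rfl | rfl <;>
        simp_all
    exact disjoint_left.2 fun x h1 h2 => key hAB x h1 h2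
  have hsup : F.sup id = univ := by
    rw [eq_univ_iff_forall]
    intro x
    simp only [F, Finset.sup_insert, Finset.sup_singleton, id, sup_eq_union, mem_union, mem_inter_iff,
      mem_sdiff, mem_compl_iff]
    tauto
  refine ⟨Finpartition.ofErase F hdisj hsup, fun E hE => ?_, fun E hE => ?_⟩
  · have hE : E ∈ F := (Finset.mem_erase.1 hE).2
    simp only [F, Finset.mem_insert, Finset.mem_singleton] at hE
    rcases hE with rfl | rfl | rfl | rfl
    · exact hX.inter hY
    · exact hX.diff hY
    · exact hY.diff hX
    · exact (hX.union hY).compl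
  · refine or_iff_not_imp_left.2 fun hne => Finset.mem_erase.2 ⟨hne, ?_⟩
    simp only [F, Finset.mem_insert, Finset.mem_singleton]
    tauto

/-- An element of `TLIM₀` is approximated on two sets at a time. -/
theorem exists_approx_two {m : StrongDual ℂ (Lp ℂ ∞ μ)} (hm : m ∈ TLIM₀ μ) {X Y : Set G}
    (hX : MeasurableSet X) (hY : MeasurableSet Y) {K : Set G} (hK : IsCompact K) {ε : ℝ}
    (hε : 0 < ε) (hε1 : ε < 1) :
    ∃ A ∈ invariantSets μ K ε,
      ‖m (ind μ X hX) - ((μ.real (A ∩ X) / μ.real A : ℝ) : ℂ)‖ < 2 * ε ∧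
      ‖m (ind μ Y hY) - ((μ.real (A ∩ Y) / μ.real A : ℝ) : ℂ)‖ < 2 * ε := by
  obtain ⟨P, hP, hparts⟩ := exists_finpartition hX hY
  obtain ⟨A, hA, happ⟩ := hm.2 P hP K ε hK hε hε1
  have hμA : μ A ≠ ∞ := hA.1.measure_lt_top.ne
  have happ' (E : Set G) (hE : MeasurableSet E)
      (h : E = X ∩ Y ∨ E = X \ Y ∨ E = Y \ X) :
      ‖m (ind μ E hE) - ((μ.real (A ∩ E) / μ.real A : ℝ) : ℂ)‖ < ε := by
    rcases hparts E h with h0 | h0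
    · rw [ind_empty μ hE h0, h0]
      simpa using hε
    · exact happ E h0
  -- Each of the two sets is a union of two cells, so the errors add up to `2ε`.
  have hsplit {S T : Set G} (hS : MeasurableSet S) (hT : MeasurableSet T)
      (h1 : ‖m (ind μ (S ∩ T) (hS.inter hT)) -
        ((μ.real (A ∩ (S ∩ T)) / μ.real A : ℝ) : ℂ)‖ < ε)
      (h2 : ‖m (ind μ (S \ T) (hS.diff hT)) -
        ((μ.real (A ∩ (S \ T)) / μ.real A : ℝ) : ℂ)‖ < ε) :
      ‖m (ind μ S hS) - ((μ.real (A ∩ S) / μ.real A : ℝ) : ℂ)‖ < 2 * ε := by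
    have h3 : μ.real (A ∩ S) = μ.real (A ∩ (S ∩ T)) + μ.real (A ∩ (S \ T)) := by
      rw [← inter_assoc, ← inter_sdiff_assoc]
      exact (measureReal_inter_add_sdiff (s := A ∩ S) hT
        (measure_ne_top_of_subset inter_subset_left hμA)).symm
    rw [← ind_inter_add_ind_diff μ hS hT, map_add, h3, add_div, Complex.ofReal_add,
      add_sub_add_comm]
    linarith [norm_add_le
      (m (ind μ (S ∩ T) (hS.inter hT)) - ((μ.real (A ∩ (S ∩ T)) / μ.real A : ℝ) : ℂ))
      (m (ind μ (S \ T) (hS.diff hT)) - ((μ.real (A ∩ (S \ T)) / μ.real A : ℝ) : ℂ))]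
  exact ⟨A, hA, hsplit hX hY (happ' _ _ (.inl rfl)) (happ' _ _ (.inr (.inl rfl))),
    hsplit hY hX (happ' _ _ (.inl (inter_comm Y X))) (happ' _ _ (.inr (.inr rfl)))⟩

theorem integral_indicator_smul_ind {A B : Set G} (hA : MeasurableSet A) (hμA : μ A ≠ ∞)
    (hB : MeasurableSet B) (x : G) :
    ∫ y, (indicatorConstLp 1 hA hμA (1 : ℝ) : Lp ℝ 1 μ) y • ind μ B hB (x⁻¹ * y) ∂μ =
      (μ.real (A ∩ (x • B)) : ℂ) := by
  have h2 : ∫ y, (A ∩ (x • B)).indicator (fun _ => (1 : ℂ)) y ∂μ =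
      (μ.real (A ∩ (x • B)) : ℂ) := by
    rw [integral_indicator (hA.inter (hB.const_smul x)), setIntegral_const]
    simp
  rw [← h2]
  refine integral_congr_ae ?_
  filter_upwards [indicatorConstLp_coeFn (p := 1) (hs := hA) (hμs := hμA) (c := (1 : ℝ)),
    (measurePreserving_mul_left μ x⁻¹).quasiMeasurePreserving.ae (coeFn_ind (μ := μ) hB)]
    with y h3 h4
  rw [h3, h4]
  have h5 : x⁻¹ * y ∈ B ↔ y ∈ x • B := by rw [mem_smul_set_iff_inv_smul_mem, smul_eq_mul]
  by_cases hy : y ∈ A <;> by_cases hy' : y ∈ x • B <;> simp [indicator, hy, hy', h5]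

theorem continuous_measureReal_inter_smul {A B : Set G} (hA : MeasurableSet A) (hμA : μ A ≠ ∞)
    (hB : MeasurableSet B) : Continuous fun x : G => μ.real (A ∩ (x • B)) := by
  refine (Complex.continuous_re.comp (continuous_integral_smul_comp μ
    (indicatorConstLp 1 hA hμA (1 : ℝ)) (ind μ B hB))).congr fun x => ?_
  rw [Function.comp_apply, integral_indicator_smul_ind μ hA hμA hB, Complex.ofReal_re]

/-- The average of `|A ∩ xB|` over `x ∈ K` is controlled by `|B⁻¹|`. -/
theorem setIntegral_measureReal_inter_smul_le {K A B : Set G} (hK : IsCompact K)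
    (hA : MeasurableSet A) (hμA : μ A ≠ ∞) (hB : MeasurableSet B) (hμB : μ B⁻¹ ≠ ∞) :
    ∫ x in K, μ.real (A ∩ (x • B)) ∂μ ≤ μ.real B⁻¹ * μ.real A := by
  let f : Lp ℝ 1 μ := indicatorConstLp 1 hK.measurableSet hK.measure_lt_top.ne (1 : ℝ)
  let g : Lp ℝ 1 μ := indicatorConstLp 1 hA hμA (1 : ℝ)
  let φ : Lp ℂ ∞ μ := ind μ B hB
  have hf : f =ᵐ[μ] K.indicator fun _ => 1 := indicatorConstLp_coeFn
  have hφ : φ =ᵐ[μ] B.indicator fun _ => 1 := coeFn_ind hB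
  have hR : ∫ x, f x • ∫ y, g y • φ (x⁻¹ * y) ∂μ ∂μ =
      ((∫ x in K, μ.real (A ∩ (x • B)) ∂μ : ℝ) : ℂ) := by
    rw [← integral_complex_ofReal, ← integral_indicator hK.measurableSet]
    refine integral_congr_ae ?_
    filter_upwards [hf] with x hx
    rw [hx, integral_indicator_smul_ind μ hA hμA hB]
    by_cases hxK : x ∈ K <;> simp [hxK]
  -- Integrating over `x` before `y ∈ A`, the inner integral is `|K ∩ yB⁻¹|`, which left invariance
  -- bounds by `|B⁻¹|`.
  have hconv (y : G) : ‖convFun μ f φ y‖ ≤ μ.real B⁻¹ := by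
    have hyB : MeasurableSet (y • B⁻¹) := hB.inv.const_smul y
    have h1 : μ (y • B⁻¹) = μ B⁻¹ := measure_smul μ y B⁻¹
    have h2 : μ.real B⁻¹ = ∫ x, (y • B⁻¹).indicator (fun _ => (1 : ℝ)) x ∂μ := by
      rw [integral_indicator hyB, setIntegral_const, measureReal_def, measureReal_def, h1]
      simp
    rw [h2]
    refine norm_integral_le_of_norm_le ?_ ?_
    · exact (integrable_indicator_iff hyB).2 (integrableOn_const (by rwa [h1]))
    · filter_upwards [hf, ae_comp_inv_mul μ hφ y] with x h3 h4
      rw [h3, h4]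
      have h5 : x⁻¹ * y ∈ B ↔ x ∈ y • B⁻¹ := by
        rw [mem_smul_set_iff_inv_smul_mem, smul_eq_mul, mem_inv, mul_inv_rev, inv_inv]
      by_cases hx : x ∈ K <;> by_cases hx' : x ∈ y • B⁻¹ <;> simp [indicator, hx, hx', h5]
  have h1 := norm_integral_smul_le μ g (.of_forall hconv)
  rw [integral_smul_convFun, hR, Complex.norm_real] at h1
  have h2 : ‖g‖ = μ.real A := by
    rw [norm_indicatorConstLp one_ne_zero ENNReal.one_ne_top]
    simp
  rw [h2] at h1
  exact (le_abs_self _).trans h1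

theorem exists_isCompact_lt_measureReal (hmod : ¬ IsUnimodular G) (c : ℝ) :
    ∃ K : Set G, IsCompact K ∧ c < μ.real K := by
  obtain ⟨V, hV, hV1⟩ := exists_compact_mem_nhds (1 : G)
  have hVpos : 0 < μ.real V :=
    ENNReal.toReal_pos (measure_pos_of_mem_nhds μ hV1).ne' hV.measure_lt_top.ne
  obtain ⟨t, ht⟩ := exists_lt_modular hmod (c / μ.real V).toNNReal
  refine ⟨(fun y => y * t) '' V, hV.image (continuous_mul_const t), ?_⟩
  rw [measureReal_def, measure_mul_right_eq, ENNReal.toReal_mul, ENNReal.coe_toReal,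
    ← measureReal_def, ← div_lt_iff₀ hVpos]
  exact (Real.le_coe_toNNReal _).trans_lt (by exact_mod_cast ht)

/-- The norm of the midpoint is bounded below through its value at `1`; for each of the two means,
positivity bounds this value below by `m(1_X) = 1`. -/
theorem re_apply_one_le_of_mem {m : StrongDual ℂ (Lp ℂ ∞ μ)} (hm : m ∈ Means μ) {X : Set G}
    (hX : MeasurableSet X) (h1 : m (ind μ X hX) = 1) : 1 ≤ (m (one μ)).re := by
  have h2 : 0 ≤ m (one μ - ind μ X hX) := by
    refine hm.2 _ ?_
    filter_upwards [Lp.coeFn_sub (one μ) (ind μ X hX), coeFn_one (μ := μ),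
      coeFn_ind (μ := μ) hX] with x h2 h3 h4
    rw [h2, Pi.sub_apply, h3, h4]
    by_cases hx : x ∈ X <;> simp [hx]
  rw [map_sub, h1] at h2
  have h3 := (Complex.nonneg_iff.1 h2).1
  simpa using h3

theorem apply_ind_nonneg {m : StrongDual ℂ (Lp ℂ ∞ μ)} (hm : m ∈ Means μ) {X : Set G}
    (hX : MeasurableSet X) : 0 ≤ (m (ind μ X hX)).re := by
  refine (Complex.nonneg_iff.1 (hm.2 _ ?_)).1
  filter_upwards [coeFn_ind (μ := μ) hX] with x hx
  rw [hx]
  exact indicator_nonneg (fun _ _ => zero_le_one) x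

theorem midpoint_mem_TLIM {m₁ m₂ : StrongDual ℂ (Lp ℂ ∞ μ)} (h₁ : m₁ ∈ TLIM μ) (h₂ : m₂ ∈ TLIM μ)
    (h₁' : 1 ≤ (m₁ (one μ)).re) (h₂' : 1 ≤ (m₂ (one μ)).re) :
    (1 / 2 : ℂ) • (m₁ + m₂) ∈ TLIM μ := by
  have happ (φ : Lp ℂ ∞ μ) :
      ((1 / 2 : ℂ) • (m₁ + m₂)) φ = ((1 / 2 : ℝ) : ℂ) * (m₁ φ + m₂ φ) := by
    simp [mul_add]
  refine ⟨⟨norm_eq_one_of_one_le μ ?_ ?_, fun φ hφ => ?_⟩, fun f hf φ => ?_⟩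
  · rw [norm_smul]
    have := norm_add_le m₁ m₂
    rw [h₁.1.1, h₂.1.1] at this
    norm_num
    linarith
  · rw [happ, Complex.re_ofReal_mul, Complex.add_re]
    linarith
  · rw [happ]
    exact mul_nonneg (by rw [Complex.zero_le_real]; norm_num)
      (add_nonneg (h₁.1.2 φ hφ) (h₂.1.2 φ hφ))
  · rw [happ, happ, h₁.2 f hf φ, h₂.2 f hf φ]

theorem notMem_TLIM₀_of_half_le (hmod : ¬ IsUnimodular G) {m : StrongDual ℂ (Lp ℂ ∞ μ)}
    {X Y : Set G} (hX : MeasurableSet X) (hY : MeasurableSet Y)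
    (hXmod : X ⊆ {x | 1 ≤ modular x}) (hYfin : μ Y < ∞)
    (hmX : 1 / 2 ≤ (m (ind μ X hX)).re) (hmY : 1 / 2 ≤ (m (ind μ Y hY)).re) :
    m ∉ TLIM₀ μ := by
  intro hm
  -- The argument yields `(5/16)|K| ≤ |A| ≤ (8/3)|Y|`, which is incompatible with `|K| > 9|Y|`
  -- because `45/16 > 8/3`.
  obtain ⟨K, hK, hKY⟩ := exists_isCompact_lt_measureReal μ hmod (9 * μ.real Y)
  obtain ⟨A, ⟨hAc, hA0, hinv⟩, hAX, hAY⟩ := exists_approx_two μ hm hX hY hK (ε := 1 / 16)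
    (by norm_num) (by norm_num)
  have hμA : μ A ≠ ∞ := hAc.measure_lt_top.ne
  have hApos : 0 < μ.real A := ENNReal.toReal_pos hA0.ne' hμA
  -- Here `3/8` is `1/2` minus the error `2 · 1/16`.
  have hlow {S : Set G} (hS : MeasurableSet S) (h1 : 1 / 2 ≤ (m (ind μ S hS)).re)
      (h2 : ‖m (ind μ S hS) - ((μ.real (A ∩ S) / μ.real A : ℝ) : ℂ)‖ < 2 * (1 / 16)) :
      3 / 8 * μ.real A ≤ μ.real (A ∩ S) := by
    have h3 := (Complex.re_le_norm _).trans_lt h2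
    rw [Complex.sub_re, Complex.ofReal_re] at h3
    rw [← le_div_iff₀ hApos]
    linarith
  have hX' := hlow hX hmX hAX
  have hY' := (hlow hY hmY hAY).trans (measureReal_mono inter_subset_right hYfin.ne)
  set B := A ∩ X with hB
  have hBm : MeasurableSet B := hAc.measurableSet.inter hX
  have hμB : μ B ≠ ∞ := measure_ne_top_of_subset inter_subset_left hμA
  have hBinv : μ B⁻¹ ≤ μ B :=
    measure_inv_le_of_one_le_modular μ hBm (inter_subset_right.trans hXmod)
  have hBinv' : μ.real B⁻¹ ≤ μ.real A :=
    (ENNReal.toReal_mono hμB hBinv).trans (measureReal_mono inter_subset_left hμA)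
  -- `xB` has measure at least `(3/8)|A|`, and the part of it outside `A` lies in `xA \ A`, of
  -- measure below `(1/16)|A|`.
  have hpt (x : G) (hx : x ∈ K) : 5 / 16 * μ.real A ≤ μ.real (A ∩ (x • B)) := by
    have h1 : μ.real (A ∆ (x • A)) < 1 / 16 * μ.real A := (div_lt_iff₀ hApos).1 (hinv x hx)
    have hxA : μ (x • A) ≠ ∞ := by rwa [measure_smul]
    have h2 : μ.real (x • B \ A) ≤ μ.real (A ∆ (x • A)) := by
      refine measureReal_mono (fun y hy => Or.inr ⟨smul_set_mono inter_subset_left hy.1, hy.2⟩) ?_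
      exact measure_ne_top_of_subset symmDiff_subset_union (measure_union_ne_top hμA hxA)
    have h3 : μ.real (x • B) = μ.real B := by rw [measureReal_def, measure_smul, measureReal_def]
    have h4 := measureReal_inter_add_sdiff (μ := μ) (s := x • B) hAc.measurableSet
      (by rwa [measure_smul])
    rw [inter_comm] at h4
    linarith
  have h1 := setIntegral_measureReal_inter_smul_le μ hK hAc.measurableSet hμA hBm
    (hBinv.trans_lt hμB.lt_top).ne
  have h2 : 5 / 16 * μ.real A * μ.real K ≤ ∫ x in K, μ.real (A ∩ (x • B)) ∂μ := by
    have hint : IntegrableOn (fun x => μ.real (A ∩ (x • B))) K μ :=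
      (continuous_measureReal_inter_smul μ hAc.measurableSet hμA hBm).continuousOn.integrableOn_compact
        hK
    have h3 := setIntegral_mono_on (integrableOn_const hK.measure_lt_top.ne) hint
      hK.measurableSet hpt
    rw [setIntegral_const, smul_eq_mul] at h3
    linarith
  have h3 : 5 / 16 * μ.real A * μ.real K ≤ μ.real A * μ.real A :=
    h2.trans (h1.trans (mul_le_mul_of_nonneg_right hBinv' hApos.le))
  have h4 : 5 / 16 * μ.real K ≤ μ.real A := by
    refine le_of_mul_le_mul_left ?_ hApos
    linarith
  linarith [measureReal_nonneg (μ := μ) (s := Y)]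

end Midpoint

end FolnerLimits

/-! ### The main theorem -/

theorem mainTheorem5 {G : Type*} [Group G] [TopologicalSpace G] [IsTopologicalGroup G]
    [LocallyCompactSpace G] [T2Space G] [SigmaCompactSpace G] [MeasurableSpace G] [BorelSpace G]
    (μ : Measure G) [μ.IsHaarMeasure] [μ.Regular]
    (hamen : FolnerLimits.IsAmenable μ) (hmod : ¬ FolnerLimits.IsUnimodular G) :
    FolnerLimits.TLIM₀ μ ≠ FolnerLimits.TLIM μ ∧
    (∀ δ : ℝ, 0 < δ →
      ∃ m₁ ∈ FolnerLimits.TLIM₀ μ, ∃ m₂ ∈ FolnerLimits.TLIM₀ μ,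
      ∃ (X Y : Set G) (hX : MeasurableSet X) (hY : MeasurableSet Y),
        X ⊆ {x | 1 ≤ FolnerLimits.modular x} ∧
        Y ⊆ {x | (FolnerLimits.modular x : ℝ) ≤ δ} ∧ μ Y ≤ 1 ∧
        m₁ (FolnerLimits.ind μ X hX) = 1 ∧ m₂ (FolnerLimits.ind μ Y hY) = 1) ∧
    (∀ m₁ ∈ FolnerLimits.TLIM₀ μ, ∀ m₂ ∈ FolnerLimits.TLIM₀ μ,
      ∀ (X Y : Set G) (hX : MeasurableSet X) (hY : MeasurableSet Y),
        X ⊆ {x | 1 ≤ FolnerLimits.modular x} → μ Y < ∞ →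
        m₁ (FolnerLimits.ind μ X hX) = 1 → m₂ (FolnerLimits.ind μ Y hY) = 1 →
        (1 / 2 : ℂ) • (m₁ + m₂) ∈ FolnerLimits.TLIM μ \ FolnerLimits.TLIM₀ μ) := by
  have h2 : ∀ m₁ ∈ FolnerLimits.TLIM₀ μ, ∀ m₂ ∈ FolnerLimits.TLIM₀ μ,
      ∀ (X Y : Set G) (hX : MeasurableSet X) (hY : MeasurableSet Y),
        X ⊆ {x | 1 ≤ FolnerLimits.modular x} → μ Y < ∞ →
        m₁ (FolnerLimits.ind μ X hX) = 1 → m₂ (FolnerLimits.ind μ Y hY) = 1 →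
        (1 / 2 : ℂ) • (m₁ + m₂) ∈ FolnerLimits.TLIM μ \ FolnerLimits.TLIM₀ μ := by
    intro m₁ hm₁ m₂ hm₂ X Y hX hY hXmod hYfin h₁ h₂
    have happ (φ : Lp ℂ ∞ μ) :
        (((1 / 2 : ℂ) • (m₁ + m₂)) φ).re = 1 / 2 * ((m₁ φ).re + (m₂ φ).re) := by
      have : ((1 / 2 : ℂ) • (m₁ + m₂)) φ = ((1 / 2 : ℝ) : ℂ) * (m₁ φ + m₂ φ) := by
        simp [mul_add]
      rw [this, Complex.re_ofReal_mul, Complex.add_re]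
    refine ⟨FolnerLimits.midpoint_mem_TLIM μ hm₁.1 hm₂.1
      (FolnerLimits.re_apply_one_le_of_mem μ hm₁.1.1 hX h₁)
      (FolnerLimits.re_apply_one_le_of_mem μ hm₂.1.1 hY h₂),
      FolnerLimits.notMem_TLIM₀_of_half_le μ hmod hX hY hXmod hYfin ?_ ?_⟩
    · rw [happ, h₁, Complex.one_re]
      linarith [FolnerLimits.apply_ind_nonneg μ hm₂.1.1 hX]
    · rw [happ, h₂, Complex.one_re]
      linarith [FolnerLimits.apply_ind_nonneg μ hm₁.1.1 hY]
  refine ⟨fun heq => ?_, fun δ hδ => FolnerLimits.exists_TLIM₀_concentrated μ hamen hmod hδ, h2⟩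
  -- Any `δ > 0` would serve: only the finiteness of `|Y|` is used.
  obtain ⟨m₁, hm₁, m₂, hm₂, X, Y, hX, hY, hXmod, -, hY1, h₁, h₂⟩ :=
    FolnerLimits.exists_TLIM₀_concentrated μ hamen hmod one_pos
  have h3 := h2 m₁ hm₁ m₂ hm₂ X Y hX hY hXmod (hY1.trans_lt ENNReal.one_lt_top) h₁ h₂
  exact h3.2 (heq ▸ h3.1)
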